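/- Let $\mathcal K$ be the class of bounded convex subsets of $\mathbb R^2$ with nonempty interior, and for $\Omega\in\mathcal K$ let $P(\Omega)$, $A(\Omega)$ and $d(\Omega)$ denote its perimeter (the length $\mathcal H^1(\partial\Omega)$ of its boundary), its area and its diameter. For $x\in(2,\pi]$ define $$\phi(x)=\inf\{A(\Omega)\mid \Omega\in\mathcal K,\ d(\Omega)=1,\ P(\Omega)=x\},\qquad \psi(x)=\sup\{A(\Omega)\mid \Omega\in\mathcal K,\ d(\Omega)=1,\ P(\Omega)=x\}.$$ Then $\phi$ and $\psi$ are well defined (for every $x\in(2,\pi]$ the set of areas is nonempty and bounded), continuous and strictly increasing on $(2,\pi]$. Moreover, the Blaschke–Santaló diagram $$\mathcal D_1=\{(P(\Omega),A(\Omega))\mid \Omega\in\mathcal K,\ d(\Omega)=1\}$$ satisfies $$\mathcal D_1=\{(x,y)\mid x\in(2,\pi],\ \phi(x)\le y\le\psi(x)\}.$$ In particular, $\mathcal D_1$ is simply connected. -/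

import Mathlib

open MeasureTheory

/-- The Euclidean plane. -/
abbrev Plane : Type := EuclideanSpace ℝ (Fin 2)

/-- The class of planar convex bodies: bounded convex subsets of the plane with nonempty
interior. -/
def planarConvexBodies : Set (Set Plane) :=
  {Ω | Convex ℝ Ω ∧ Bornology.IsBounded Ω ∧ (interior Ω).Nonempty}

/-- The area: two-dimensional Lebesgue measure. -/
noncomputable def area (Ω : Set Plane) : ℝ :=
  (volume Ω).toReal

/-- The perimeter of a convex body: the length (one-dimensional Hausdorff measure, in Mathlib's
normalization, for which a segment has its usual length) of its topological boundary. -/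
noncomputable def perimeter (Ω : Set Plane) : ℝ :=
  (Measure.hausdorffMeasure 1 (frontier Ω)).toReal

/-- The Blaschke–Santaló diagram of the triplet `(J₁, J₂, J₃)` for the class `F`. -/
def blaschkeSantaloDiagram (F : Set (Set Plane)) (J₁ J₂ J₃ : Set Plane → ℝ) : Set (ℝ × ℝ) :=
  {p | ∃ Ω ∈ F, J₃ Ω = 1 ∧ p = (J₁ Ω, J₂ Ω)}

/-- The diagram of the triplet (perimeter, area, diameter) for planar convex bodies. -/
noncomputable def diagramPAd : Set (ℝ × ℝ) :=
  blaschkeSantaloDiagram planarConvexBodies perimeter area Metric.diam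

/-- The set of areas of the planar convex bodies of unit diameter and perimeter `x`. -/
def areaValues (x : ℝ) : Set ℝ :=
  {a | ∃ Ω ∈ planarConvexBodies, Metric.diam Ω = 1 ∧ perimeter Ω = x ∧ area Ω = a}

/-- The infimum of the area among planar convex bodies of unit diameter and perimeter `x`
(used only for `2 < x ≤ π`). -/
noncomputable def phi (x : ℝ) : ℝ := sInf (areaValues x)

/-- The supremum of the area among planar convex bodies of unit diameter and perimeter `x`
(used only for `2 < x ≤ π`). -/
noncomputable def psi (x : ℝ) : ℝ := sSup (areaValues x)

/-! ### Support functions, widths and the width integral. -/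

section Plane

open Set Real
open scoped Pointwise InnerProductSpace

/-! By Cauchy's formula (`hausdorffMeasure_frontier`) the perimeter of a convex body is the integral
of its width over directions in `[0, π]`. In this form it is additive under Minkowski sums and
continuous for the Hausdorff distance. After taking closures and applying an isometry, a body of
unit diameter becomes an `IsUnitBody`: it contains two fixed points at distance one. Sharing these
poles keeps the diameter equal to one under Minkowski interpolation, along which the perimeter is
affine and the area continuous. Flat bodies are allowed, so Blaschke selection makes the set of
pairs (width integral, area) compact; the flat ones have width integral 2 and drop out over `(2,
π]`.

Interpolating between two bodies of equal perimeter shows that each fiber is an interval. Strict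
monotonicity of the envelopes comes from two deformations. Squashing towards the line of the poles
lowers the perimeter to any value above 2 and strictly lowers the area
(`IsUnitBody.exists_smaller_area`). Central symmetrization keeps the perimeter, does not lower the
area and puts the body inside the disc of diameter one; interpolation with that disc then strictly
enlarges it (`IsUnitBody.exists_larger_area`). Continuity of each envelope follows on one side from
compactness, on the other from monotonicity and interpolation paths. The diagram thus lies between
two graphs over an interval and contracts. -/

theorem plane_inner (x y : Plane) : ⟪x, y⟫_ℝ = x 0 * y 0 + x 1 * y 1 := by
  simp [PiLp.inner_apply, Fin.sum_univ_two, mul_comm]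

theorem plane_norm_sq (x : Plane) : ‖x‖ ^ 2 = x 0 ^ 2 + x 1 ^ 2 := by
  rw [← real_inner_self_eq_norm_sq, plane_inner]; ring

theorem plane_ext {x y : Plane} (h0 : x 0 = y 0) (h1 : x 1 = y 1) : x = y := by
  ext i; fin_cases i
  · exact h0
  · exact h1

/-- The unit vector of angle `θ`. -/
noncomputable def dir (θ : ℝ) : Plane := !₂[cos θ, sin θ]

@[simp] theorem dir_zero_apply (θ : ℝ) : dir θ 0 = cos θ := rfl
@[simp] theorem dir_one_apply (θ : ℝ) : dir θ 1 = sin θ := rfl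

theorem continuous_dir : Continuous dir := by
  unfold dir
  refine (PiLp.continuous_toLp 2 _).comp ?_
  refine continuous_pi fun i => ?_
  fin_cases i
  · exact continuous_cos
  · exact continuous_sin

@[simp] theorem norm_dir (θ : ℝ) : ‖dir θ‖ = 1 := by
  have h : ‖dir θ‖ ^ 2 = 1 := by rw [plane_norm_sq]; simp
  nlinarith [norm_nonneg (dir θ)]

theorem exists_eq_smul_dir (v : Plane) : ∃ α : ℝ, v = ‖v‖ • dir α := by
  refine ⟨Complex.arg ⟨v 0, v 1⟩, ?_⟩
  have hn : ‖(⟨v 0, v 1⟩ : ℂ)‖ = ‖v‖ := by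
    have h1 : ‖(⟨v 0, v 1⟩ : ℂ)‖ ^ 2 = ‖v‖ ^ 2 := by
      rw [plane_norm_sq, Complex.sq_norm, Complex.normSq_mk]; ring
    nlinarith [norm_nonneg v, norm_nonneg (⟨v 0, v 1⟩ : ℂ)]
  apply plane_ext
  · have := Complex.norm_mul_cos_arg ⟨v 0, v 1⟩
    simp only [hn] at this
    simpa using this.symm
  · have := Complex.norm_mul_sin_arg ⟨v 0, v 1⟩
    simp only [hn] at this
    simpa using this.symm

theorem integral_abs_cos : ∫ θ in (0 : ℝ)..π, |cos θ| = 2 := by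
  have hper : Function.Periodic (fun θ => |cos θ|) π := fun x => by simp [cos_add_pi]
  have h := hper.intervalIntegral_add_eq 0 (-(π / 2))
  rw [zero_add] at h
  rw [h, show -(π / 2) + π = π / 2 by ring]
  have h2 : ∫ θ in (-(π / 2))..(π / 2), |cos θ| = ∫ θ in (-(π / 2))..(π / 2), cos θ := by
    refine intervalIntegral.integral_congr fun θ hθ => ?_
    rw [uIcc_of_le (by linarith [pi_pos])] at hθ
    exact abs_of_nonneg (cos_nonneg_of_mem_Icc hθ)
  rw [h2, integral_cos]; simp; norm_num

/-- Crofton's formula for one segment: in polar form the integrand is a shifted `|cos|`, and the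
shift does not affect an integral over a full period. -/
theorem integral_abs_inner_dir (v : Plane) : ∫ θ in (0 : ℝ)..π, |⟪dir θ, v⟫_ℝ| = 2 * ‖v‖ := by
  obtain ⟨α, hα⟩ := exists_eq_smul_dir v
  have h1 : ∀ θ, |⟪dir θ, v⟫_ℝ| = ‖v‖ * |cos (θ - α)| := fun θ => by
    conv_lhs => rw [hα]
    rw [inner_smul_right, abs_mul, abs_norm, plane_inner, cos_sub]; simp
  have hper : Function.Periodic (fun θ => |cos θ|) π := fun x => by simp [cos_add_pi]
  simp_rw [h1]
  rw [intervalIntegral.integral_const_mul,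
    intervalIntegral.integral_comp_sub_right (fun θ => |cos θ|) α]
  have h := hper.intervalIntegral_add_eq (0 - α) 0
  rw [show 0 - α + π = π - α by ring, zero_add] at h
  rw [h, integral_abs_cos]; ring

/-- The support function of a set. -/
noncomputable def supp (K : Set Plane) (v : Plane) : ℝ := sSup ((fun x => ⟪v, x⟫_ℝ) '' K)

variable {K L : Set Plane}

theorem bddAbove_inner_image (hK : IsCompact K) (v : Plane) :
    BddAbove ((fun x => ⟪v, x⟫_ℝ) '' K) :=
  (hK.image (by fun_prop)).bddAbove

theorem inner_le_supp (hK : IsCompact K) (v : Plane) {x : Plane} (hx : x ∈ K) :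
    ⟪v, x⟫_ℝ ≤ supp K v :=
  le_csSup (bddAbove_inner_image hK v) ⟨x, hx, rfl⟩

theorem supp_le (hne : K.Nonempty) {v : Plane} {c : ℝ} (h : ∀ x ∈ K, ⟪v, x⟫_ℝ ≤ c) :
    supp K v ≤ c :=
  csSup_le (hne.image _) (by rintro _ ⟨x, hx, rfl⟩; exact h x hx)

theorem exists_inner_eq_supp (hK : IsCompact K) (hne : K.Nonempty) (v : Plane) :
    ∃ x ∈ K, ⟪v, x⟫_ℝ = supp K v :=
  (hK.image (by fun_prop : Continuous fun x => ⟪v, x⟫_ℝ)).sSup_mem (hne.image _)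

theorem continuous_supp (hK : IsCompact K) : Continuous (supp K) :=
  hK.continuous_sSup (f := fun v x => ⟪v, x⟫_ℝ) (by fun_prop)

theorem supp_mono (hL : IsCompact L) (hne : K.Nonempty) (h : K ⊆ L) (v : Plane) :
    supp K v ≤ supp L v :=
  supp_le hne fun _ hx => inner_le_supp hL v (h hx)

theorem isCompact_minkowski (hK : IsCompact K) (hL : IsCompact L) (a b : ℝ) :
    IsCompact (a • K + b • L) :=
  (hK.smul a).add (hL.smul b)

theorem supp_minkowski (hK : IsCompact K) (hKne : K.Nonempty) (hL : IsCompact L)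
    (hLne : L.Nonempty) {a b : ℝ} (ha : 0 ≤ a) (hb : 0 ≤ b) (v : Plane) :
    supp (a • K + b • L) v = a * supp K v + b * supp L v := by
  apply le_antisymm
  · refine supp_le (hKne.smul_set.add hLne.smul_set) ?_
    rintro _ ⟨_, ⟨x, hx, rfl⟩, _, ⟨y, hy, rfl⟩, rfl⟩
    simp only [inner_add_right, inner_smul_right]
    gcongr
    · exact inner_le_supp hK v hx
    · exact inner_le_supp hL v hy
  · obtain ⟨x, hx, hxv⟩ := exists_inner_eq_supp hK hKne v
    obtain ⟨y, hy, hyv⟩ := exists_inner_eq_supp hL hLne v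
    rw [← hxv, ← hyv, ← inner_smul_right, ← inner_smul_right, ← inner_add_right]
    exact inner_le_supp (isCompact_minkowski hK hL a b) v
      (add_mem_add (smul_mem_smul_set hx) (smul_mem_smul_set hy))

/-- The width of a set in the direction `v`. -/
noncomputable def width (K : Set Plane) (v : Plane) : ℝ := supp K v + supp K (-v)

theorem continuous_width (hK : IsCompact K) : Continuous (width K) :=
  (continuous_supp hK).add ((continuous_supp hK).comp continuous_neg)

theorem width_mono (hL : IsCompact L) (hne : K.Nonempty) (h : K ⊆ L) (v : Plane) :
    width K v ≤ width L v :=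
  add_le_add (supp_mono hL hne h v) (supp_mono hL hne h (-v))

theorem width_minkowski (hK : IsCompact K) (hKne : K.Nonempty) (hL : IsCompact L)
    (hLne : L.Nonempty) {a b : ℝ} (ha : 0 ≤ a) (hb : 0 ≤ b) (v : Plane) :
    width (a • K + b • L) v = a * width K v + b * width L v := by
  unfold width
  rw [supp_minkowski hK hKne hL hLne ha hb, supp_minkowski hK hKne hL hLne ha hb]; ring

theorem inner_sub_le_width (hK : IsCompact K) (v : Plane) {x y : Plane} (hx : x ∈ K)
    (hy : y ∈ K) : ⟪v, x - y⟫_ℝ ≤ width K v := by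
  have h1 := inner_le_supp hK v hx
  have h2 := inner_le_supp hK (-v) hy
  rw [inner_neg_left] at h2
  rw [inner_sub_right, width]; linarith

theorem abs_inner_sub_le_width (hK : IsCompact K) (v : Plane) {x y : Plane} (hx : x ∈ K)
    (hy : y ∈ K) : |⟪v, x - y⟫_ℝ| ≤ width K v := by
  rw [abs_le]
  have h1 := inner_sub_le_width hK v hx hy
  have h2 := inner_sub_le_width hK v hy hx
  rw [← neg_sub, inner_neg_right] at h2
  constructor <;> linarith

theorem exists_inner_sub_eq_width (hK : IsCompact K) (hne : K.Nonempty) (v : Plane) :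
    ∃ x ∈ K, ∃ y ∈ K, ⟪v, x - y⟫_ℝ = width K v := by
  obtain ⟨x, hx, hxv⟩ := exists_inner_eq_supp hK hne v
  obtain ⟨y, hy, hyv⟩ := exists_inner_eq_supp hK hne (-v)
  refine ⟨x, hx, y, hy, ?_⟩
  rw [width, ← hxv, ← hyv, inner_sub_right, inner_neg_left]; ring

theorem width_neg_set (hK : IsCompact K) (hne : K.Nonempty) (v : Plane) :
    width (-K) v = width K v := by
  apply le_antisymm
  · obtain ⟨x, hx, y, hy, h⟩ := exists_inner_sub_eq_width hK.neg hne.neg v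
    rw [← h, show x - y = -y - -x by abel]
    exact inner_sub_le_width hK v hy hx
  · obtain ⟨x, hx, y, hy, h⟩ := exists_inner_sub_eq_width hK hne v
    rw [← h, show x - y = -y - -x by abel]
    exact inner_sub_le_width hK.neg v (neg_mem_neg.2 hy) (neg_mem_neg.2 hx)

/-- The integral of the width over all directions; by Cauchy's formula this is the perimeter. -/
noncomputable def widthIntegral (K : Set Plane) : ℝ := ∫ θ in (0 : ℝ)..π, width K (dir θ)

theorem intervalIntegrable_width (hK : IsCompact K) (a b : ℝ) :
    IntervalIntegrable (fun θ => width K (dir θ)) volume a b :=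
  ((continuous_width hK).comp continuous_dir).intervalIntegrable a b

theorem widthIntegral_mono (hK : IsCompact K) (hL : IsCompact L) (hne : K.Nonempty)
    (h : K ⊆ L) : widthIntegral K ≤ widthIntegral L :=
  intervalIntegral.integral_mono_on pi_pos.le (intervalIntegrable_width hK _ _)
    (intervalIntegrable_width hL _ _) fun _ _ => width_mono hL hne h _

/-- Support functions are linear in the body for nonnegative coefficients; this makes the perimeter
affine along Minkowski interpolation. -/
theorem widthIntegral_minkowski (hK : IsCompact K) (hKne : K.Nonempty) (hL : IsCompact L)
    (hLne : L.Nonempty) {a b : ℝ} (ha : 0 ≤ a) (hb : 0 ≤ b) :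
    widthIntegral (a • K + b • L) = a * widthIntegral K + b * widthIntegral L := by
  unfold widthIntegral
  simp_rw [width_minkowski hK hKne hL hLne ha hb]
  rw [intervalIntegral.integral_add ((intervalIntegrable_width hK _ _).const_mul a)
    ((intervalIntegrable_width hL _ _).const_mul b), intervalIntegral.integral_const_mul,
    intervalIntegral.integral_const_mul]

theorem widthIntegral_neg_set (hK : IsCompact K) (hne : K.Nonempty) :
    widthIntegral (-K) = widthIntegral K := by
  unfold widthIntegral
  simp_rw [width_neg_set hK hne]

theorem widthIntegral_smul (hK : IsCompact K) (hne : K.Nonempty) {a : ℝ} (ha : 0 ≤ a) :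
    widthIntegral (a • K) = a * widthIntegral K := by
  have h := widthIntegral_minkowski hK hne hK hne ha le_rfl
  rwa [zero_smul_set hne, add_zero, zero_mul, add_zero] at h

/-- A translation is a Minkowski sum with a point, whose width is zero. -/
theorem widthIntegral_vadd (hK : IsCompact K) (hne : K.Nonempty) (y : Plane) :
    widthIntegral (y +ᵥ K) = widthIntegral K := by
  have h := widthIntegral_minkowski hK hne (isCompact_singleton (x := y)) (singleton_nonempty y)
    zero_le_one zero_le_one
  have h0 : widthIntegral {y} = 0 := by
    unfold widthIntegral width supp
    simp
  rw [one_smul, one_smul, h0, add_comm K, singleton_add, mul_zero, add_zero,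
    one_mul] at h
  exact h

end Plane

/-! ### Monotonicity of boundary length. -/

section HausdorffMonotone

open Set Real Measure
open scoped Pointwise InnerProductSpace

/-- A supporting functional at a point outside the interior, as an inner product. -/
theorem exists_supporting_vector {K : Set Plane} (hK : Convex ℝ K) (hint : (interior K).Nonempty)
    {x : Plane} (hx : x ∉ interior K) : ∃ n : Plane, ‖n‖ = 1 ∧ ∀ y ∈ K, ⟪n, y⟫_ℝ ≤ ⟪n, x⟫_ℝ := by
  obtain ⟨f, hf, h⟩ := geometric_hahn_banach_of_nonempty_interior_point hK hx hint
  set m := (InnerProductSpace.toDual ℝ Plane).symm f with hm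
  have hm0 : m ≠ 0 := by simpa [hm] using hf
  have hmf : ∀ y, ⟪m, y⟫_ℝ = f y := fun y => InnerProductSpace.toDual_symm_apply
  have hpos : 0 < ‖m‖ := norm_pos_iff.2 hm0
  refine ⟨‖m‖⁻¹ • m, by rw [norm_smul, norm_inv, norm_norm, inv_mul_cancel₀ hpos.ne'], ?_⟩
  intro y hy
  rw [real_inner_smul_left, real_inner_smul_left, hmf, hmf]
  exact mul_le_mul_of_nonneg_left (h y hy) (inv_nonneg.2 hpos.le)

theorem exists_strictly_separating_vector {K : Set Plane} (hK : Convex ℝ K) (hcl : IsClosed K)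
    {x : Plane} (hx : x ∉ K) :
    ∃ (n : Plane) (c : ℝ), ‖n‖ = 1 ∧ (∀ y ∈ K, ⟪n, y⟫_ℝ ≤ c) ∧ c < ⟪n, x⟫_ℝ := by
  rcases K.eq_empty_or_nonempty with rfl | hne
  · exact ⟨dir 0, ⟪dir 0, x⟫_ℝ - 1, norm_dir 0, by simp, by simp⟩
  obtain ⟨f, c, h1, h2⟩ := geometric_hahn_banach_closed_point hK hcl hx
  set m := (InnerProductSpace.toDual ℝ Plane).symm f with hm
  have hmf : ∀ y, ⟪m, y⟫_ℝ = f y := fun y => InnerProductSpace.toDual_symm_apply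
  have hm0 : m ≠ 0 := by
    intro h0
    obtain ⟨y, hy⟩ := hne
    have := (h1 y hy).trans h2
    rw [← hmf, ← hmf, h0] at this
    simp at this
  have hpos : 0 < ‖m‖ := norm_pos_iff.2 hm0
  refine ⟨‖m‖⁻¹ • m, ‖m‖⁻¹ * c, by rw [norm_smul, norm_inv, norm_norm, inv_mul_cancel₀ hpos.ne'],
    fun y hy => ?_, ?_⟩
  · rw [real_inner_smul_left, hmf]
    exact mul_le_mul_of_nonneg_left (h1 y hy).le (inv_nonneg.2 hpos.le)
  · rw [real_inner_smul_left, hmf]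
    exact mul_lt_mul_of_pos_left h2 (inv_pos.2 hpos)

/-- The boundary length of planar convex sets is monotone: the nearest-point projection onto the
smaller set is a contraction mapping the larger boundary onto the smaller one. -/
theorem hausdorffMeasure_frontier_mono {K L : Set Plane} (hK : Convex ℝ K) (hKc : IsCompact K)
    (hint : (interior K).Nonempty) (hL : Bornology.IsBounded L) (hKL : K ⊆ L) :
    μH[1] (frontier K) ≤ μH[1] (frontier L) := by
  have hne : K.Nonempty := hint.mono interior_subset
  have hex : ∀ u : Plane, ∃ v ∈ K, ∀ w ∈ K, ⟪u - v, w - v⟫_ℝ ≤ 0 := fun u => by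
    obtain ⟨v, hv, h⟩ := exists_norm_eq_iInf_of_complete_convex hne hKc.isComplete hK u
    exact ⟨v, hv, (norm_eq_iInf_iff_real_inner_le_zero hK hv).1 h⟩
  choose p hp hpin using hex
  have hlip : LipschitzWith 1 p := by
    refine LipschitzWith.of_dist_le_mul fun x y => ?_
    rw [NNReal.coe_one, one_mul, dist_eq_norm, dist_eq_norm]
    -- Adding the two variational inequalities and applying Cauchy–Schwarz shows that the projection
    -- is a contraction.
    have h1 := hpin x (p y) (hp y)
    have h2 := hpin y (p x) (hp x)
    have h3 : ‖p x - p y‖ ^ 2 ≤ ⟪x - y, p x - p y⟫_ℝ := by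
      rw [← real_inner_self_eq_norm_sq]
      have e1 : ⟪x - p x, p y - p x⟫_ℝ = ⟪p x, p x - p y⟫_ℝ - ⟪x, p x - p y⟫_ℝ := by
        rw [← inner_sub_left, ← neg_sub (p x) (p y), inner_neg_right, ← inner_neg_left, neg_sub]
      have e2 : ⟪y - p y, p x - p y⟫_ℝ = ⟪y, p x - p y⟫_ℝ - ⟪p y, p x - p y⟫_ℝ := inner_sub_left ..
      have e3 : ⟪p x - p y, p x - p y⟫_ℝ = ⟪p x, p x - p y⟫_ℝ - ⟪p y, p x - p y⟫_ℝ :=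
        inner_sub_left ..
      have e4 : ⟪x - y, p x - p y⟫_ℝ = ⟪x, p x - p y⟫_ℝ - ⟪y, p x - p y⟫_ℝ := inner_sub_left ..
      linarith
    have h4 := real_inner_le_norm (x - y) (p x - p y)
    by_contra! hlt
    nlinarith [norm_nonneg (x - y), norm_nonneg (p x - p y)]
  have hsub : frontier K ⊆ p '' frontier L := by
    intro x hx
    have hxK : x ∈ K := hKc.isClosed.frontier_subset hx
    obtain ⟨n, hn, hsup⟩ := exists_supporting_vector hK hint hx.2
    -- The outward normal ray from `x` must leave the bounded set `L`. With `|t|` it is defined on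
    -- all of `ℝ`, whose connectedness yields a frontier point of the preimage.
    let g : ℝ → Plane := fun t => x + |t| • n
    have hg : Continuous g := by fun_prop
    have h0 : (frontier (g ⁻¹' L)).Nonempty := by
      refine nonempty_frontier_iff.2 ⟨⟨0, by simpa [g] using hKL hxK⟩, fun huniv => ?_⟩
      obtain ⟨R, hR⟩ := hL.subset_closedBall x
      have h5 : g (|R| + 1) ∈ L := by
        have : |R| + 1 ∈ g ⁻¹' L := huniv ▸ mem_univ _
        exact this
      have h6 := hR h5
      rw [Metric.mem_closedBall, dist_eq_norm] at h6
      simp only [g, add_sub_cancel_left, norm_smul, hn, mul_one, norm_eq_abs, abs_abs] at h6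
      have h7 : |(|R| + 1)| = |R| + 1 := abs_of_nonneg (by positivity)
      rw [h7] at h6
      linarith [le_abs_self R]
    obtain ⟨t, ht⟩ := h0
    refine ⟨g t, hg.frontier_preimage_subset L ht, ?_⟩
    -- Every point of the normal ray projects back to `x`: the variational inequality and the
    -- support inequality force the distance to vanish.
    have h1 := hpin (g t) x hxK
    have h2 := hsup (p (g t)) (hp _)
    have h3 : ‖x - p (g t)‖ ^ 2 ≤ 0 := by
      rw [← real_inner_self_eq_norm_sq]
      have e1 : ⟪g t - p (g t), x - p (g t)⟫_ℝ = ⟪x - p (g t), x - p (g t)⟫_ℝ +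
          |t| * (⟪n, x⟫_ℝ - ⟪n, p (g t)⟫_ℝ) := by
        rw [← inner_sub_right, ← real_inner_smul_left, ← inner_add_left]
        congr 1
        simp only [g]
        abel
      have e2 := mul_nonneg (abs_nonneg t) (sub_nonneg.2 h2)
      linarith
    have h4 : x - p (g t) = 0 := norm_eq_zero.1 (by nlinarith [norm_nonneg (x - p (g t))])
    exact (sub_eq_zero.1 h4).symm
  calc μH[1] (frontier K) ≤ μH[1] (p '' frontier L) := measure_mono hsub
    _ ≤ μH[1] (frontier L) := by
      simpa using hlip.hausdorffMeasure_image_le zero_le_one (frontier L)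

end HausdorffMonotone

/-! ### Cauchy's formula for polygons. -/

section Polygon

open Set Real Measure
open scoped Pointwise InnerProductSpace

theorem eq_of_two_inner_eq {n m x y : Plane} (hdet : n 0 * m 1 - n 1 * m 0 ≠ 0)
    (hn : ⟪n, x⟫_ℝ = ⟪n, y⟫_ℝ) (hm : ⟪m, x⟫_ℝ = ⟪m, y⟫_ℝ) : x = y := by
  rw [plane_inner, plane_inner] at hn hm
  apply plane_ext
  · refine mul_left_cancel₀ hdet ?_
    linear_combination m 1 * hn - n 1 * hm
  · refine mul_left_cancel₀ hdet ?_
    linear_combination -m 0 * hn + n 0 * hm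

theorem eq_or_eq_neg_of_det_eq_zero {n m : Plane} (hn : ‖n‖ = 1) (hm : ‖m‖ = 1)
    (hdet : n 0 * m 1 - n 1 * m 0 = 0) : m = n ∨ m = -n := by
  have hn2 := plane_norm_sq n
  have hm2 := plane_norm_sq m
  rw [hn, one_pow] at hn2
  rw [hm, one_pow] at hm2
  have h : (n 0 * m 0 + n 1 * m 1) ^ 2 = 1 := by
    linear_combination (-(m 0 ^ 2 + m 1 ^ 2)) * hn2 - hm2 - (n 0 * m 1 - n 1 * m 0) * hdet
  rcases sq_eq_sq_iff_eq_or_eq_neg.1 (h.trans (one_pow 2).symm) with h | h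
  · left
    have : (m 0 - n 0) ^ 2 + (m 1 - n 1) ^ 2 = 0 := by linear_combination -hn2 - hm2 - 2 * h
    apply plane_ext <;> nlinarith [sq_nonneg (m 0 - n 0), sq_nonneg (m 1 - n 1)]
  · right
    have : (m 0 + n 0) ^ 2 + (m 1 + n 1) ^ 2 = 0 := by linear_combination -hn2 - hm2 + 2 * h
    apply plane_ext <;> simp <;> nlinarith [sq_nonneg (m 0 + n 0), sq_nonneg (m 1 + n 1)]

/-- The intersection of the half-planes `⟪n, x⟫ ≤ c`, for `(n, c)` in a finite set. -/
def polygon (T : Finset (Plane × ℝ)) : Set Plane := {x | ∀ p ∈ T, ⟪p.1, x⟫_ℝ ≤ p.2}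

/-- The part of a polygon on the boundary line of one of its half-planes. -/
def edge (T : Finset (Plane × ℝ)) (p : Plane × ℝ) : Set Plane :=
  {x ∈ polygon T | ⟪p.1, x⟫_ℝ = p.2}

variable {T : Finset (Plane × ℝ)}

theorem convex_polygon : Convex ℝ (polygon T) := by
  intro x hx y hy a b ha hb hab p hp
  rw [inner_add_right, inner_smul_right, inner_smul_right]
  have h1 := mul_le_mul_of_nonneg_left (hx p hp) ha
  have h2 := mul_le_mul_of_nonneg_left (hy p hp) hb
  calc a * ⟪p.1, x⟫_ℝ + b * ⟪p.1, y⟫_ℝ ≤ a * p.2 + b * p.2 := add_le_add h1 h2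
    _ = p.2 := by rw [← add_mul, hab, one_mul]

theorem isClosed_polygon : IsClosed (polygon T) := by
  have : polygon T = ⋂ p ∈ T, {x | ⟪p.1, x⟫_ℝ ≤ p.2} := by ext; simp [polygon]
  rw [this]
  exact isClosed_biInter fun p _ => isClosed_le (by fun_prop) continuous_const

theorem convex_edge (p : Plane × ℝ) : Convex ℝ (edge T p) := by
  intro x hx y hy a b ha hb hab
  refine ⟨convex_polygon hx.1 hy.1 ha hb hab, ?_⟩
  rw [inner_add_right, inner_smul_right, inner_smul_right, hx.2, hy.2, ← add_mul, hab, one_mul]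

theorem isCompact_edge (hT : IsCompact (polygon T)) (p : Plane × ℝ) : IsCompact (edge T p) :=
  hT.inter_right (isClosed_eq (f := fun x => ⟪p.1, x⟫_ℝ) (by fun_prop) continuous_const)

theorem interior_polygon (hunit : ∀ p ∈ T, ‖p.1‖ = 1) :
    interior (polygon T) = {x | ∀ p ∈ T, ⟪p.1, x⟫_ℝ < p.2} := by
  apply Subset.antisymm
  · intro x hx p hp
    obtain ⟨ε, hε, hball⟩ := Metric.isOpen_iff.1 isOpen_interior x hx
    have hmem : x + (ε / 2) • p.1 ∈ polygon T := by
      refine interior_subset (hball ?_)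
      rw [Metric.mem_ball, dist_eq_norm, add_sub_cancel_left, norm_smul, hunit p hp, mul_one,
        norm_eq_abs, abs_of_pos (half_pos hε)]
      linarith
    have := hmem p hp
    rw [inner_add_right, inner_smul_right, real_inner_self_eq_norm_sq, hunit p hp] at this
    linarith
  · refine interior_maximal (fun x hx p hp => (hx p hp).le) ?_
    have : {x : Plane | ∀ p ∈ T, ⟪p.1, x⟫_ℝ < p.2} = ⋂ p ∈ T, {x | ⟪p.1, x⟫_ℝ < p.2} := by
      ext; simp
    rw [this]
    exact isOpen_biInter_finset fun p _ => isOpen_lt (by fun_prop) continuous_const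

theorem frontier_polygon (hunit : ∀ p ∈ T, ‖p.1‖ = 1) :
    frontier (polygon T) = ⋃ p ∈ T, edge T p := by
  rw [isClosed_polygon.frontier_eq, interior_polygon hunit]
  ext x
  simp only [mem_sdiff, mem_ofPred_eq, mem_iUnion, edge, exists_prop]
  constructor
  · rintro ⟨h1, h2⟩
    push Not at h2
    obtain ⟨p, hp, hle⟩ := h2
    exact ⟨p, hp, h1, le_antisymm (h1 p hp) hle⟩
  · rintro ⟨p, hp, h1, h2⟩
    exact ⟨h1, fun h => (h p hp).ne h2⟩

/-- Transversal lines meet at most once. Equal normals with a common point would make the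
constraints equal, and opposite normals would leave no interior. -/
theorem subsingleton_edge_inter_edge (hunit : ∀ p ∈ T, ‖p.1‖ = 1)
    (hint : (interior (polygon T)).Nonempty) {p q : Plane × ℝ} (hp : p ∈ T) (hq : q ∈ T)
    (hpq : p ≠ q) : (edge T p ∩ edge T q).Subsingleton := by
  rintro x ⟨hxp, hxq⟩ y ⟨hyp, hyq⟩
  by_cases hdet : p.1 0 * q.1 1 - p.1 1 * q.1 0 = 0
  · exfalso
    rcases eq_or_eq_neg_of_det_eq_zero (hunit p hp) (hunit q hq) hdet with h | h
    · exact hpq (Prod.ext h.symm (by rw [← hxp.2, ← hxq.2, h]))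
    · obtain ⟨z, hz⟩ := hint
      rw [interior_polygon hunit] at hz
      have h1 := hz p hp
      have h2 := hz q hq
      have h3 := hxq.2
      rw [h, inner_neg_left] at h2 h3
      linarith [hxp.2]
  · exact eq_of_two_inner_eq hdet (hxp.2.trans hyp.2.symm) (hxq.2.trans hyq.2.symm)

/-- The line through a point of a polygon leaves it through exactly one edge, in general. -/
theorem volume_image_polygon (hT : IsCompact (polygon T)) (hunit : ∀ p ∈ T, ‖p.1‖ = 1)
    (hint : (interior (polygon T)).Nonempty) {e f : Plane} (hf : ‖f‖ = 1)
    (hef : ⟪e, f⟫_ℝ = 0) (hdec : ∀ x : Plane, x = ⟪e, x⟫_ℝ • e + ⟪f, x⟫_ℝ • f) :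
    volume ((fun x => ⟪e, x⟫_ℝ) '' polygon T) =
      ∑ p ∈ T with 0 < ⟪p.1, f⟫_ℝ, volume ((fun x => ⟪e, x⟫_ℝ) '' edge T p) := by
  have hcont : Continuous fun x : Plane => ⟪e, x⟫_ℝ := by fun_prop
  have hU : (fun x => ⟪e, x⟫_ℝ) '' polygon T =
      ⋃ p ∈ T.filter (fun p => 0 < ⟪p.1, f⟫_ℝ), (fun x => ⟪e, x⟫_ℝ) '' edge T p := by
    apply Subset.antisymm
    · rintro _ ⟨x, hx, rfl⟩
      have hc : IsCompact (polygon T ∩ {y | ⟪e, y⟫_ℝ = ⟪e, x⟫_ℝ}) :=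
        hT.inter_right (isClosed_eq hcont continuous_const)
      -- The highest point, in direction `f`, over a point of the shadow must lie on an edge whose
      -- normal has a positive `f`-component; otherwise it could be moved up slightly.
      obtain ⟨y, ⟨hyT, hyx⟩, hmax⟩ := hc.exists_isMaxOn ⟨x, hx, rfl⟩
        (f := fun y => ⟪f, y⟫_ℝ) (by fun_prop)
      have : ∃ p ∈ T, 0 < ⟪p.1, f⟫_ℝ ∧ ⟪p.1, y⟫_ℝ = p.2 := by
        by_contra! hcon
        have hev : ∀ᶠ ε in nhdsWithin (0 : ℝ) (Ioi 0), ∀ p ∈ T, ⟪p.1, y + ε • f⟫_ℝ ≤ p.2 := by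
          refine (Filter.eventually_all_finset T).2 fun p hp => ?_
          by_cases hpos : 0 < ⟪p.1, f⟫_ℝ
          · have hlt : ⟪p.1, y + (0 : ℝ) • f⟫_ℝ < p.2 := by
              rw [zero_smul, add_zero]
              exact lt_of_le_of_ne (hyT p hp) (hcon p hp hpos)
            have hca : ContinuousAt (fun ε : ℝ => ⟪p.1, y + ε • f⟫_ℝ) 0 := by fun_prop
            exact ((hca.eventually_lt continuousAt_const hlt).filter_mono
              nhdsWithin_le_nhds).mono fun _ h => h.le
          · filter_upwards [self_mem_nhdsWithin] with ε hε
            rw [inner_add_right, inner_smul_right]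
            have := hyT p hp
            have h2 : ε * ⟪p.1, f⟫_ℝ ≤ 0 :=
              mul_nonpos_of_nonneg_of_nonpos (le_of_lt hε) (not_lt.1 hpos)
            linarith
        obtain ⟨ε, hε, hpos⟩ := (hev.and self_mem_nhdsWithin).exists
        have hmem : y + ε • f ∈ polygon T ∩ {y | ⟪e, y⟫_ℝ = ⟪e, x⟫_ℝ} := by
          refine ⟨hε, ?_⟩
          change ⟪e, y + ε • f⟫_ℝ = _
          rw [inner_add_right, inner_smul_right, hef, mul_zero, add_zero]
          exact hyx
        have h1 : ⟪f, y + ε • f⟫_ℝ ≤ ⟪f, y⟫_ℝ := hmax hmem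
        rw [inner_add_right, inner_smul_right, real_inner_self_eq_norm_sq, hf] at h1
        have : (0 : ℝ) < ε := hpos
        linarith
      obtain ⟨p, hp, hpos, heq⟩ := this
      refine mem_biUnion (Finset.mem_filter.2 ⟨hp, hpos⟩) ⟨y, ⟨hyT, heq⟩, hyx⟩
    · refine iUnion₂_subset fun p _ => image_mono fun x hx => hx.1
  rw [hU]
  refine measure_biUnion_finset₀ ?_ fun p _ =>
    ((isCompact_edge hT p).image hcont).measurableSet.nullMeasurableSet
  intro p hp q hq hpq
  rw [Finset.mem_coe, Finset.mem_filter] at hp hq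
  have hsub : ((fun x => ⟪e, x⟫_ℝ) '' edge T p) ∩ ((fun x => ⟪e, x⟫_ℝ) '' edge T q) ⊆
      (fun x => ⟪e, x⟫_ℝ) '' (edge T p ∩ edge T q) := by
    rintro _ ⟨⟨x, hx, rfl⟩, ⟨y, hy, hyx⟩⟩
    have hyx' : ⟪e, y⟫_ℝ = ⟪e, x⟫_ℝ := hyx
    have key : ∀ n z : Plane, ⟪n, z⟫_ℝ = ⟪e, z⟫_ℝ * ⟪n, e⟫_ℝ + ⟪f, z⟫_ℝ * ⟪n, f⟫_ℝ := by
      intro n z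
      conv_lhs => rw [hdec z, inner_add_right, inner_smul_right, inner_smul_right]
    -- Each of `x`, `y` obeys the constraint active at the other. As both normals point upwards,
    -- their heights agree, so shadows of distinct edges overlap in at most a point.
    have h1 := hy.1 p hp.1
    have h2 := hx.1 q hq.1
    rw [← hx.2, key p.1 y, key p.1 x, hyx'] at h1
    rw [← hy.2, key q.1 y, key q.1 x, hyx'] at h2
    have h3 : ⟪f, y⟫_ℝ ≤ ⟪f, x⟫_ℝ := le_of_mul_le_mul_right (by linarith) hp.2
    have h4 : ⟪f, x⟫_ℝ ≤ ⟪f, y⟫_ℝ := le_of_mul_le_mul_right (by linarith) hq.2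
    have hxy : y = x := by rw [hdec y, hdec x, hyx', le_antisymm h3 h4]
    exact ⟨x, ⟨hx, hxy ▸ hy⟩, rfl⟩
  exact measure_mono_null hsub
    (((subsingleton_edge_inter_edge hunit hint hp.1 hq.1 hpq).image _).measure_zero _)

/-- The upper edges cover the shadow once, the lower edges once more, and edges parallel to `f`
project to points. -/
theorem two_mul_volume_image_polygon (hT : IsCompact (polygon T))
    (hunit : ∀ p ∈ T, ‖p.1‖ = 1) (hint : (interior (polygon T)).Nonempty) {e f : Plane}
    (hf : ‖f‖ = 1) (hef : ⟪e, f⟫_ℝ = 0) (hdec : ∀ x : Plane, x = ⟪e, x⟫_ℝ • e + ⟪f, x⟫_ℝ • f) :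
    ∑ p ∈ T, volume ((fun x => ⟪e, x⟫_ℝ) '' edge T p) =
      2 * volume ((fun x => ⟪e, x⟫_ℝ) '' polygon T) := by
  have h1 := volume_image_polygon hT hunit hint hf hef hdec
  have h2 := volume_image_polygon hT hunit hint (f := -f) (by rwa [norm_neg])
    (by rw [inner_neg_right, hef, neg_zero]) (fun x => by
      rw [inner_neg_left, smul_neg, neg_smul, neg_neg]; exact hdec x)
  have h0 : ∀ p ∈ T, ⟪p.1, f⟫_ℝ = 0 → volume ((fun x => ⟪e, x⟫_ℝ) '' edge T p) = 0 := by
    intro p hp hpf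
    refine Set.Subsingleton.measure_zero ?_ _
    rintro _ ⟨x, hx, rfl⟩ _ ⟨y, hy, rfl⟩
    have hp1 : p.1 = ⟪e, p.1⟫_ℝ • e := by
      conv_lhs => rw [hdec p.1, real_inner_comm, real_inner_comm p.1 f, hpf, zero_smul, add_zero]
      rw [real_inner_comm]
    have hne : ⟪e, p.1⟫_ℝ ≠ 0 := by
      intro h
      rw [h, zero_smul] at hp1
      have := hunit p hp
      rw [hp1, norm_zero] at this
      exact zero_ne_one this
    have hxy : ⟪p.1, x⟫_ℝ = ⟪p.1, y⟫_ℝ := hx.2.trans hy.2.symm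
    rw [hp1, real_inner_smul_left, real_inner_smul_left] at hxy
    exact mul_left_cancel₀ hne hxy
  rw [two_mul]
  nth_rw 1 [h1]
  rw [h2, Finset.sum_filter, Finset.sum_filter, ← Finset.sum_add_distrib]
  refine Finset.sum_congr rfl fun p hp => ?_
  rw [inner_neg_right]
  rcases lt_trichotomy ⟪p.1, f⟫_ℝ 0 with h | h | h
  · simp [h, h.not_gt]
  · simp [h, h0 p hp h]
  · simp [h, h.not_gt]

theorem image_inner_eq_Icc {K : Set Plane} (hK : IsCompact K) (hconv : Convex ℝ K)
    (hne : K.Nonempty) (e : Plane) :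
    (fun x => ⟪e, x⟫_ℝ) '' K = Icc (-supp K (-e)) (supp K e) := by
  apply Subset.antisymm
  · rintro _ ⟨x, hx, rfl⟩
    have h := inner_le_supp hK (-e) hx
    rw [inner_neg_left] at h
    exact ⟨by simp only; linarith, inner_le_supp hK e hx⟩
  · obtain ⟨x, hx, hxe⟩ := exists_inner_eq_supp hK hne e
    obtain ⟨y, hy, hye⟩ := exists_inner_eq_supp hK hne (-e)
    rw [inner_neg_left] at hye
    have hc : Convex ℝ ((fun x => ⟪e, x⟫_ℝ) '' K) :=
      hconv.is_linear_image (f := fun x => ⟪e, x⟫_ℝ) ((innerₛₗ ℝ e).isLinear)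
    rw [← hxe, ← hye, neg_neg]
    exact hc.ordConnected.out ⟨y, hy, rfl⟩ ⟨x, hx, rfl⟩

theorem volume_image_inner {K : Set Plane} (hK : IsCompact K) (hconv : Convex ℝ K)
    (hne : K.Nonempty) (e : Plane) :
    volume ((fun x => ⟪e, x⟫_ℝ) '' K) = ENNReal.ofReal (width K e) := by
  rw [image_inner_eq_Icc hK hconv hne, Real.volume_Icc, sub_neg_eq_add, width]

/-- An edge is a segment between its extremes along its line, so the difference of the endpoints
encodes both its length and all its projections. An empty edge gets the zero vector. -/
theorem exists_edge_vector (hT : IsCompact (polygon T)) {p : Plane × ℝ} (hp : ‖p.1‖ = 1) :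
    ∃ v : Plane, μH[1] (edge T p) = ENNReal.ofReal ‖v‖ ∧
      ∀ e : Plane, volume ((fun x => ⟪e, x⟫_ℝ) '' edge T p) = ENNReal.ofReal |⟪e, v⟫_ℝ| := by
  have hEc := isCompact_edge hT p
  rcases (edge T p).eq_empty_or_nonempty with hE | hE
  · exact ⟨0, by simp [hE]⟩
  set g : Plane := !₂[-p.1 1, p.1 0] with hg
  have hdet : p.1 0 * g 1 - p.1 1 * g 0 ≠ 0 := by
    have := plane_norm_sq p.1
    rw [hp] at this
    simp [hg]
    nlinarith
  obtain ⟨a, ha, hamax⟩ := hEc.exists_isMaxOn hE (f := fun y => ⟪g, y⟫_ℝ) (by fun_prop)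
  obtain ⟨b, hb, hbmin⟩ := hEc.exists_isMinOn hE (f := fun y => ⟪g, y⟫_ℝ) (by fun_prop)
  have hseg : edge T p = segment ℝ a b := by
    refine Subset.antisymm (fun x hx => ?_) ((convex_edge p).segment_subset ha hb)
    have h1 : ⟪g, x⟫_ℝ ≤ ⟪g, a⟫_ℝ := hamax hx
    have h2 : ⟪g, b⟫_ℝ ≤ ⟪g, x⟫_ℝ := hbmin hx
    have h3 : ⟪g, x⟫_ℝ ∈ segment ℝ ⟪g, b⟫_ℝ ⟪g, a⟫_ℝ := by
      rw [segment_eq_Icc (h2.trans h1)]; exact ⟨h2, h1⟩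
    rw [segment_symm]
    obtain ⟨s, t, hs, ht, hst, hx'⟩ := h3
    refine ⟨s, t, hs, ht, hst, eq_of_two_inner_eq hdet ?_ ?_⟩
    · rw [inner_add_right, inner_smul_right, inner_smul_right, ha.2, hb.2, hx.2, ← add_mul, hst,
        one_mul]
    · rw [inner_add_right, inner_smul_right, inner_smul_right, ← hx']; simp
  refine ⟨a - b, ?_, fun e => ?_⟩
  · rw [hseg, hausdorffMeasure_segment, edist_dist, dist_eq_norm]
  · rw [hseg]
    have := image_segment ℝ (innerₛₗ ℝ e).toAffineMap a b
    simp only [LinearMap.coe_toAffineMap, innerₛₗ_apply_apply] at this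
    have h2 : (fun x => ⟪e, x⟫_ℝ) '' segment ℝ a b = segment ℝ ⟪e, a⟫_ℝ ⟪e, b⟫_ℝ := this
    rw [h2, segment_eq_uIcc, Real.volume_interval, abs_sub_comm, inner_sub_right]

/-- In each direction the edge projections add up to twice the width; integrating over directions
turns each projection into twice the edge length. -/
theorem hausdorffMeasure_frontier_polygon (hT : IsCompact (polygon T))
    (hunit : ∀ p ∈ T, ‖p.1‖ = 1) (hint : (interior (polygon T)).Nonempty) :
    μH[1] (frontier (polygon T)) = ENNReal.ofReal (widthIntegral (polygon T)) := by
  have hne := hint.mono interior_subset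
  have hex : ∀ p : Plane × ℝ, ∃ v : Plane, p ∈ T → μH[1] (edge T p) = ENNReal.ofReal ‖v‖ ∧
      ∀ e : Plane, volume ((fun x => ⟪e, x⟫_ℝ) '' edge T p) = ENNReal.ofReal |⟪e, v⟫_ℝ| := by
    intro p
    by_cases hp : p ∈ T
    · obtain ⟨v, hv⟩ := exists_edge_vector hT (hunit p hp)
      exact ⟨v, fun _ => hv⟩
    · exact ⟨0, fun h => absurd h hp⟩
  choose v hv using hex
  rw [frontier_polygon hunit]
  have h1 : μH[1] (⋃ p ∈ T, edge T p) = ∑ p ∈ T, μH[1] (edge T p) := by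
    refine measure_biUnion_finset₀ ?_ fun p _ =>
      (isCompact_edge hT p).measurableSet.nullMeasurableSet
    intro p hp q hq hpq
    have : NullSingletonClass (μH[1] : Measure Plane) := Measure.nullSingletonClass_hausdorff _ one_pos
    exact (subsingleton_edge_inter_edge hunit hint hp hq hpq).measure_zero _
  rw [h1, Finset.sum_congr rfl fun p hp => (hv p hp).1,
    ← ENNReal.ofReal_sum_of_nonneg fun p _ => norm_nonneg _]
  congr 1
  have hwn : ∀ e, 0 ≤ width (polygon T) e := fun e => by
    obtain ⟨x, hx⟩ := hne
    have := inner_sub_le_width hT e hx hx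
    simpa using this
  have h2 : ∀ θ, ∑ p ∈ T, |⟪dir θ, v p⟫_ℝ| = 2 * width (polygon T) (dir θ) := by
    intro θ
    have h3 := two_mul_volume_image_polygon hT hunit hint (e := dir θ) (f := dir (θ + π / 2))
      (norm_dir _) (by rw [plane_inner]; simp [cos_add_pi_div_two, sin_add_pi_div_two]; ring)
      (fun x => by
        have hcs := sin_sq_add_cos_sq θ
        apply plane_ext <;> simp [plane_inner, cos_add_pi_div_two, sin_add_pi_div_two]
        · linear_combination -x 0 * hcs
        · linear_combination -x 1 * hcs)
    rw [Finset.sum_congr rfl fun p hp => (hv p hp).2 (dir θ),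
      ← ENNReal.ofReal_sum_of_nonneg fun p _ => abs_nonneg _,
      volume_image_inner hT convex_polygon hne, two_mul,
      ← ENNReal.ofReal_add (hwn _) (hwn _), ← two_mul] at h3
    exact (ENNReal.ofReal_eq_ofReal_iff (Finset.sum_nonneg fun _ _ => abs_nonneg _)
      (mul_nonneg zero_le_two (hwn _))).1 h3
  have h4 : ∫ θ in (0 : ℝ)..π, ∑ p ∈ T, |⟪dir θ, v p⟫_ℝ| = ∑ p ∈ T, 2 * ‖v p‖ := by
    rw [intervalIntegral.integral_finsetSum]
    · exact Finset.sum_congr rfl fun p _ => integral_abs_inner_dir (v p)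
    · intro p _
      exact (Continuous.abs (continuous_dir.inner continuous_const)).intervalIntegrable _ _
  simp_rw [h2] at h4
  rw [intervalIntegral.integral_const_mul, ← Finset.mul_sum] at h4
  exact (mul_left_cancel₀ two_ne_zero h4).symm

end Polygon

/-! ### Cauchy's formula for convex bodies, by polygonal approximation. -/

section Cauchy

open Set Real Measure
open scoped Pointwise InnerProductSpace

theorem hausdorffMeasure_frontier_image (e : Plane ≃ᵢ Plane) (K : Set Plane) :
    μH[1] (frontier (e '' K)) = μH[1] (frontier K) := by
  have h : frontier (e '' K) = e '' frontier K := (e.toHomeomorph.image_frontier K).symm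
  rw [h, e.hausdorffMeasure_image]

theorem hausdorffMeasure_frontier_smul {c : ℝ} (hc : 0 < c) (K : Set Plane) :
    μH[1] (frontier (c • K)) = ENNReal.ofReal c * μH[1] (frontier K) := by
  have h : frontier (c • K) = c • frontier K :=
    ((Homeomorph.smulOfNeZero c hc.ne').image_frontier K).symm
  rw [h, hausdorffMeasure_smul₀ zero_le_one hc.ne', NNReal.rpow_one, ENNReal.smul_def,
    smul_eq_mul, ENNReal.ofReal_eq_coe_nnreal hc.le, Real.nnnorm_of_nonneg hc.le]

/-- Each frontier point of `c • K` can be strictly separated from `K`, and by compactness finitely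
many of the separating half-planes exclude the whole frontier. -/
theorem exists_polygon_between {K : Set Plane} (hK : Convex ℝ K) (hKc : IsCompact K)
    (h0 : (0 : Plane) ∈ interior K) {c : ℝ} (hc : 1 < c) :
    ∃ T : Finset (Plane × ℝ), (∀ p ∈ T, ‖p.1‖ = 1) ∧ K ⊆ polygon T ∧ polygon T ⊆ c • K := by
  classical
  have hsub : K ⊆ interior (c • K) := by
    have h := hK.closure_subset_interior_image_homothety_of_one_lt h0 c hc
    have h2 : AffineMap.homothety (0 : Plane) c '' K = c • K := by
      ext x; simp [AffineMap.homothety_apply, mem_smul_set]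
    rw [h2] at h
    exact subset_closure.trans h
  have hcK : IsCompact (c • K) := hKc.smul c
  have hfr : IsCompact (frontier (c • K)) :=
    hcK.of_isClosed_subset isClosed_frontier hcK.isClosed.frontier_subset
  have hex : ∀ x : Plane, ∃ p : Plane × ℝ, x ∈ frontier (c • K) →
      ‖p.1‖ = 1 ∧ (∀ y ∈ K, ⟪p.1, y⟫_ℝ ≤ p.2) ∧ p.2 < ⟪p.1, x⟫_ℝ := by
    intro x
    by_cases hx : x ∈ frontier (c • K)
    · obtain ⟨n, d, h⟩ := exists_strictly_separating_vector hK hKc.isClosed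
        (fun hxK => hx.2 (hsub hxK))
      exact ⟨(n, d), fun _ => h⟩
    · exact ⟨0, fun h => absurd h hx⟩
  choose p hp using hex
  obtain ⟨t, htC, htcov⟩ := hfr.elim_nhds_subcover (fun x => {y | (p x).2 < ⟪(p x).1, y⟫_ℝ})
    fun x hx => (isOpen_lt continuous_const (by fun_prop)).mem_nhds (hp x hx).2.2
  refine ⟨t.image p, ?_, ?_, ?_⟩
  · simp only [Finset.mem_image]
    rintro _ ⟨x, hx, rfl⟩
    exact (hp x (htC x hx)).1
  · intro y hy q hq
    obtain ⟨x, hx, rfl⟩ := Finset.mem_image.1 hq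
    exact (hp x (htC x hx)).2.1 y hy
  · have hKT : (0 : Plane) ∈ polygon (t.image p) := by
      intro q hq
      obtain ⟨x, hx, rfl⟩ := Finset.mem_image.1 hq
      exact (hp x (htC x hx)).2.1 0 (interior_subset h0)
    -- The polygon is connected, contains `0` and misses the frontier of `c • K`, so it cannot leave
    -- the interior.
    refine (convex_polygon.isPreconnected.subset_left_of_subset_union isOpen_interior
      hcK.isClosed.isOpen_compl ?_ ?_ ⟨0, hKT, hsub (interior_subset h0)⟩).trans interior_subset
    · exact disjoint_compl_right.mono_left interior_subset
    · intro y hy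
      by_contra hcon
      rw [mem_union, not_or, mem_compl_iff, not_not] at hcon
      have hyf : y ∈ frontier (c • K) := by
        rw [hcK.isClosed.frontier_eq]; exact ⟨hcon.2, hcon.1⟩
      obtain ⟨x, hx, hlt⟩ := mem_iUnion₂.1 (htcov hyf)
      exact absurd (hy (p x) (Finset.mem_image_of_mem p hx)) (not_le.2 hlt)

theorem le_of_forall_one_lt_le_mul_right {a b : ℝ} (h : ∀ c, 1 < c → a ≤ c * b) : a ≤ b := by
  have ht : Filter.Tendsto (fun c : ℝ => c * b) (nhdsWithin 1 (Ioi 1)) (nhds (1 * b)) :=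
    ((continuous_id.mul continuous_const).tendsto 1).mono_left nhdsWithin_le_nhds
  rw [one_mul] at ht
  exact ge_of_tendsto ht (by filter_upwards [self_mem_nhdsWithin] with c hc using h c hc)

theorem widthIntegral_nonneg {K : Set Plane} (hK : IsCompact K) (hne : K.Nonempty) :
    0 ≤ widthIntegral K := by
  obtain ⟨x, hx⟩ := hne
  refine intervalIntegral.integral_nonneg pi_pos.le fun θ _ => ?_
  simpa using inner_sub_le_width hK (dir θ) hx hx

/-- **Cauchy's formula** for the boundary length of a planar convex body. -/
theorem hausdorffMeasure_frontier {K : Set Plane} (hK : Convex ℝ K) (hKc : IsCompact K)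
    (hint : (interior K).Nonempty) :
    μH[1] (frontier K) = ENNReal.ofReal (widthIntegral K) := by
  -- With the origin inside, the dilates `c • K` with `c > 1` contain `K` in their interior and
  -- shrink to it as `c` tends to 1.
  wlog h0 : (0 : Plane) ∈ interior K generalizing K
  · obtain ⟨y, hy⟩ := hint
    have hi : interior (-y +ᵥ K) = -y +ᵥ interior K :=
      ((Homeomorph.vadd (-y)).image_interior K).symm
    have h0' : (0 : Plane) ∈ interior (-y +ᵥ K) := by
      rw [hi]; exact ⟨y, hy, by simp⟩
    have h1 := this (hK.vadd (-y)) (hKc.vadd (-y)) ⟨0, h0'⟩ h0'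
    rw [widthIntegral_vadd hKc ⟨y, interior_subset hy⟩] at h1
    rw [← h1]
    exact (hausdorffMeasure_frontier_image (IsometryEquiv.constVAdd (-y)) K).symm
  have hne : K.Nonempty := hint.mono interior_subset
  have hW := widthIntegral_nonneg hKc hne
  have key : ∀ c, 1 < c → μH[1] (frontier K) ≤ ENNReal.ofReal (c * widthIntegral K) ∧
      ENNReal.ofReal (widthIntegral K) ≤ ENNReal.ofReal c * μH[1] (frontier K) := by
    intro c hc
    have hc0 : 0 < c := one_pos.trans hc
    obtain ⟨T, hT, hKT, hTK⟩ := exists_polygon_between hK hKc h0 hc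
    have hTc : IsCompact (polygon T) :=
      (hKc.smul c).of_isClosed_subset isClosed_polygon hTK
    have hTint : (interior (polygon T)).Nonempty := hint.mono (interior_mono hKT)
    have hTne := hne.mono hKT
    have hf := hausdorffMeasure_frontier_polygon hTc hT hTint
    constructor
    · calc μH[1] (frontier K) ≤ μH[1] (frontier (polygon T)) :=
            hausdorffMeasure_frontier_mono hK hKc hint hTc.isBounded hKT
        _ = ENNReal.ofReal (widthIntegral (polygon T)) := hf
        _ ≤ ENNReal.ofReal (widthIntegral (c • K)) :=
            ENNReal.ofReal_le_ofReal (widthIntegral_mono hTc (hKc.smul c) hTne hTK)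
        _ = _ := by rw [widthIntegral_smul hKc hne hc0.le]
    · calc ENNReal.ofReal (widthIntegral K) ≤ ENNReal.ofReal (widthIntegral (polygon T)) :=
            ENNReal.ofReal_le_ofReal (widthIntegral_mono hKc hTc hne hKT)
        _ = μH[1] (frontier (polygon T)) := hf.symm
        _ ≤ μH[1] (frontier (c • K)) :=
            hausdorffMeasure_frontier_mono convex_polygon hTc hTint (hKc.smul c).isBounded hTK
        _ = _ := hausdorffMeasure_frontier_smul hc0 K
  -- Any factor above 1 serves to show finiteness.
  have hfin : μH[1] (frontier K) ≠ ⊤ := ne_top_of_le_ne_top ENNReal.ofReal_ne_top (key 2 one_lt_two).1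
  rw [← ENNReal.ofReal_toReal hfin] at key ⊢
  congr 1
  apply le_antisymm
  · refine le_of_forall_one_lt_le_mul_right fun c hc => ?_
    exact (ENNReal.ofReal_le_ofReal_iff (mul_nonneg (one_pos.trans hc).le hW)).1 (key c hc).1
  · refine le_of_forall_one_lt_le_mul_right fun c hc => ?_
    have h := (key c hc).2
    rw [← ENNReal.ofReal_mul (one_pos.trans hc).le] at h
    exact (ENNReal.ofReal_le_ofReal_iff
      (mul_nonneg (one_pos.trans hc).le ENNReal.toReal_nonneg)).1 h

theorem perimeter_eq_widthIntegral {K : Set Plane} (hK : Convex ℝ K) (hKc : IsCompact K)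
    (hint : (interior K).Nonempty) : perimeter K = widthIntegral K := by
  rw [perimeter, hausdorffMeasure_frontier hK hKc hint,
    ENNReal.toReal_ofReal (widthIntegral_nonneg hKc (hint.mono interior_subset))]

end Cauchy

/-! ### Continuity of perimeter and area in the Hausdorff distance. -/

section HausdorffConvergence

open Set Real Filter Topology
open scoped Pointwise InnerProductSpace

/-- Every point of either set is within `ε` of the other set. -/
def HausdorffClose (ε : ℝ) (K L : Set Plane) : Prop :=
  (∀ x ∈ K, ∃ y ∈ L, dist x y ≤ ε) ∧ ∀ y ∈ L, ∃ x ∈ K, dist x y ≤ ε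

/-- Convergence of sets in the Hausdorff distance. -/
def HausdorffTendsto {ι : Type*} (l : Filter ι) (K : ι → Set Plane) (L : Set Plane) : Prop :=
  ∀ ε > 0, ∀ᶠ i in l, HausdorffClose ε (K i) L

variable {K L : Set Plane} {ε : ℝ}

theorem HausdorffClose.symm (h : HausdorffClose ε K L) : HausdorffClose ε L K :=
  ⟨fun x hx => (h.2 x hx).imp fun y hy => ⟨hy.1, dist_comm x y ▸ hy.2⟩,
    fun y hy => (h.1 y hy).imp fun x hx => ⟨hx.1, dist_comm x y ▸ hx.2⟩⟩

theorem supp_le_of_close (hL : IsCompact L) (hKne : K.Nonempty) (h : HausdorffClose ε K L)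
    {v : Plane} (hv : ‖v‖ = 1) : supp K v ≤ supp L v + ε := by
  refine supp_le hKne fun x hx => ?_
  obtain ⟨y, hy, hxy⟩ := h.1 x hx
  have h1 := inner_le_supp hL v hy
  have h2 := real_inner_le_norm v (x - y)
  rw [hv, one_mul, inner_sub_right, ← dist_eq_norm] at h2
  linarith

theorem abs_width_sub_le_of_close (hK : IsCompact K) (hL : IsCompact L) (hKne : K.Nonempty)
    (hLne : L.Nonempty) (h : HausdorffClose ε K L) {v : Plane} (hv : ‖v‖ = 1) :
    |width K v - width L v| ≤ 2 * ε := by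
  have hv' : ‖-v‖ = 1 := by rwa [norm_neg]
  have h1 := supp_le_of_close hL hKne h hv
  have h2 := supp_le_of_close hL hKne h hv'
  have h3 := supp_le_of_close hK hLne h.symm hv
  have h4 := supp_le_of_close hK hLne h.symm hv'
  unfold width
  rw [abs_le]
  constructor <;> linarith

theorem abs_widthIntegral_sub_le_of_close (hK : IsCompact K) (hL : IsCompact L)
    (hKne : K.Nonempty) (hLne : L.Nonempty) (h : HausdorffClose ε K L) :
    |widthIntegral K - widthIntegral L| ≤ 2 * ε * π := by
  unfold widthIntegral
  rw [← intervalIntegral.integral_sub (intervalIntegrable_width hK _ _)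
    (intervalIntegrable_width hL _ _)]
  have := intervalIntegral.norm_integral_le_of_norm_le_const (a := 0) (b := π) (C := 2 * ε)
    (f := fun θ => width K (dir θ) - width L (dir θ))
    fun θ _ => abs_width_sub_le_of_close hK hL hKne hLne h (norm_dir θ)
  rwa [sub_zero, abs_of_pos pi_pos, norm_eq_abs] at this

theorem tendsto_widthIntegral {ι : Type*} {l : Filter ι} {K : ι → Set Plane}
    (hK : ∀ i, IsCompact (K i)) (hL : IsCompact L) (hKne : ∀ i, (K i).Nonempty)
    (hLne : L.Nonempty) (h : HausdorffTendsto l K L) :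
    Tendsto (fun i => widthIntegral (K i)) l (𝓝 (widthIntegral L)) := by
  rw [Metric.tendsto_nhds]
  intro ε hε
  have hpi := pi_pos
  filter_upwards [h (ε / (4 * π)) (by positivity)] with i hi
  have h1 := abs_widthIntegral_sub_le_of_close (hK i) hL (hKne i) hLne hi
  rw [dist_eq]
  have : 2 * (ε / (4 * π)) * π = ε / 2 := by field_simp; norm_num
  linarith

/-- If `x` were outside `L`, moving from `x` by `r` along a separating normal would reach a point of
`K` farther than `ε` from `L`. Applied with `L` an approximant, this puts interior points of the
limit set in it. -/
theorem mem_of_closedBall_subset_of_close (hL : Convex ℝ L) (hLc : IsClosed L) {x : Plane}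
    {r : ℝ} (hr : 0 ≤ r) (hball : Metric.closedBall x r ⊆ K) (hεr : ε < r)
    (h : ∀ y ∈ K, ∃ z ∈ L, dist z y ≤ ε) : x ∈ L := by
  by_contra hx
  obtain ⟨n, c, hn, hle, hlt⟩ := exists_strictly_separating_vector hL hLc hx
  have hy : x + r • n ∈ K := hball (by
    rw [Metric.mem_closedBall, dist_eq_norm, add_sub_cancel_left, norm_smul, hn, mul_one,
      norm_eq_abs, abs_of_nonneg hr])
  obtain ⟨z, hz, hzy⟩ := h _ hy
  have h1 := real_inner_le_norm n (x + r • n - z)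
  rw [hn, one_mul, ← dist_eq_norm, dist_comm, inner_sub_right, inner_add_right, inner_smul_right,
    real_inner_self_eq_norm_sq, hn] at h1
  have := hle z hz
  linarith

/-- Indicators converge off the frontier of the limit, which is null by convexity, and a fixed ball
eventually contains all the sets. -/
theorem tendsto_area {ι : Type*} {l : Filter ι} [l.IsCountablyGenerated] {K : ι → Set Plane}
    (hK : ∀ i, IsCompact (K i)) (hKconv : ∀ i, Convex ℝ (K i)) (hL : IsCompact L)
    (hLconv : Convex ℝ L) (h : HausdorffTendsto l K L) :
    Tendsto (fun i => area (K i)) l (𝓝 (area L)) := by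
  obtain ⟨R, hR⟩ := hL.isBounded.subset_closedBall 0
  refine (ENNReal.tendsto_toReal hL.measure_ne_top).comp ?_
  refine tendsto_measure_of_ae_tendsto_indicator l hL.measurableSet
    (fun i => (hK i).measurableSet) (B := Metric.closedBall 0 (R + 1))
    Metric.isClosed_closedBall.measurableSet (isCompact_closedBall _ _).measure_ne_top ?_ ?_
  · filter_upwards [h 1 one_pos] with i hi x hx
    obtain ⟨y, hy, hxy⟩ := hi.1 x hx
    have := hR hy
    rw [Metric.mem_closedBall] at this ⊢
    linarith [dist_triangle x y 0]
  · have hfr : ∀ᵐ x ∂(volume : Measure Plane), x ∉ frontier L :=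
      measure_eq_zero_iff_ae_notMem.1 (hLconv.addHaar_frontier _)
    filter_upwards [hfr] with x hx
    by_cases hxL : x ∈ L
    · have hint : x ∈ interior L := by
        by_contra hcon
        exact hx ⟨subset_closure hxL, hcon⟩
      obtain ⟨r, hr, hball⟩ := Metric.nhds_basis_closedBall.mem_iff.1 (mem_interior_iff_mem_nhds.1 hint)
      filter_upwards [h (r / 2) (half_pos hr)] with i hi
      exact iff_of_true (mem_of_closedBall_subset_of_close (hKconv i) (hK i).isClosed hr.le hball
        (half_lt_self hr) hi.2) hxL
    · obtain ⟨r, hr, hball⟩ := Metric.nhds_basis_closedBall.mem_iff.1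
        (hL.isClosed.isOpen_compl.mem_nhds hxL)
      filter_upwards [h (r / 2) (half_pos hr)] with i hi
      refine iff_of_false (fun hxK => ?_) hxL
      obtain ⟨y, hy, hxy⟩ := hi.1 x hxK
      exact hball (Metric.mem_closedBall.2 (by rw [dist_comm]; linarith)) hy

end HausdorffConvergence

/-! ### Normalized bodies of unit diameter. -/

section UnitBody

open Set Real Filter Topology
open scoped Pointwise InnerProductSpace

/-- One of the two endpoints of a horizontal unit segment centered at the origin. -/
noncomputable def pole : Plane := !₂[1 / 2, 0]

@[simp] theorem pole_zero : pole 0 = 1 / 2 := rfl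
@[simp] theorem pole_one : pole 1 = 0 := rfl

theorem norm_pole_sub_neg_pole : ‖pole - -pole‖ = 1 := by
  have h : ‖pole - -pole‖ ^ 2 = 1 := by
    rw [plane_norm_sq]
    simp
    norm_num
  nlinarith [norm_nonneg (pole - -pole)]

/-- Compact convex sets of diameter one, a diameter being the segment between the poles. -/
structure IsUnitBody (K : Set Plane) : Prop where
  isCompact : IsCompact K
  convex : Convex ℝ K
  pole_mem : pole ∈ K
  neg_pole_mem : -pole ∈ K
  dist_le : ∀ x ∈ K, ∀ y ∈ K, dist x y ≤ 1

variable {K L : Set Plane}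

theorem IsUnitBody.nonempty (hK : IsUnitBody K) : K.Nonempty := ⟨pole, hK.pole_mem⟩

/-- Distances are at most convex combinations of distances, and the shared poles survive, so the
diameter cannot drop below one. -/
theorem IsUnitBody.minkowski (hK : IsUnitBody K) (hL : IsUnitBody L) {t : ℝ} (h0 : 0 ≤ t)
    (h1 : t ≤ 1) : IsUnitBody ((1 - t) • K + t • L) := by
  have hs : ∀ x : Plane, (1 - t) • x + t • x = x := fun x => by rw [← add_smul]; simp
  refine ⟨isCompact_minkowski hK.isCompact hL.isCompact _ _,
    (hK.convex.smul _).add (hL.convex.smul _), ?_, ?_, ?_⟩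
  · rw [← hs pole]
    exact add_mem_add (smul_mem_smul_set hK.pole_mem) (smul_mem_smul_set hL.pole_mem)
  · rw [← hs (-pole)]
    exact add_mem_add (smul_mem_smul_set hK.neg_pole_mem) (smul_mem_smul_set hL.neg_pole_mem)
  · rintro _ ⟨_, ⟨x, hx, rfl⟩, _, ⟨y, hy, rfl⟩, rfl⟩ _ ⟨_, ⟨x', hx', rfl⟩, _, ⟨y', hy', rfl⟩, rfl⟩
    have e1 := hK.dist_le x hx x' hx'
    have e2 := hL.dist_le y hy y' hy'
    calc dist ((1 - t) • x + t • y) ((1 - t) • x' + t • y')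
        ≤ dist ((1 - t) • x) ((1 - t) • x') + dist (t • y) (t • y') := dist_add_add_le _ _ _ _
      _ = (1 - t) * dist x x' + t * dist y y' := by
        rw [dist_smul₀, dist_smul₀, norm_eq_abs, norm_eq_abs, abs_of_nonneg h0,
          abs_of_nonneg (sub_nonneg.2 h1)]
      _ ≤ (1 - t) * 1 + t * 1 := by
        gcongr
      _ = 1 := by ring

theorem IsUnitBody.widthIntegral_minkowski (hK : IsUnitBody K) (hL : IsUnitBody L) {t : ℝ}
    (h0 : 0 ≤ t) (h1 : t ≤ 1) : widthIntegral ((1 - t) • K + t • L) =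
      (1 - t) * widthIntegral K + t * widthIntegral L :=
  _root_.widthIntegral_minkowski hK.isCompact hK.nonempty hL.isCompact hL.nonempty
    (sub_nonneg.2 h1) h0

theorem hausdorffTendsto_minkowski (hK : IsUnitBody K) (hL : IsUnitBody L) (t₀ : ℝ) :
    HausdorffTendsto (𝓝 t₀) (fun t : ℝ => (1 - t) • K + t • L) ((1 - t₀) • K + t₀ • L) := by
  intro ε hε
  have key : ∀ s t : ℝ, dist t t₀ < ε / 2 → dist s t ≤ dist t t₀ → ∀ x ∈ K, ∀ y ∈ L,
      dist ((1 - t) • x + t • y) ((1 - s) • x + s • y) ≤ ε := by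
    intro s t hts hst x hx y hy
    -- Both sets contain `pole` and have diameter at most one.
    have h1 : dist x y ≤ 2 := by
      have := dist_triangle x pole y
      have := hK.dist_le x hx pole hK.pole_mem
      have := hL.dist_le pole hL.pole_mem y hy
      linarith
    rw [dist_eq_norm, show (1 - t) • x + t • y - ((1 - s) • x + s • y) = (s - t) • (x - y) by
      module, norm_smul, ← dist_eq_norm, ← dist_eq_norm]
    calc dist s t * dist x y ≤ (ε / 2) * 2 := by
          gcongr
          exact hst.trans hts.le
      _ = ε := by ring
  filter_upwards [Metric.ball_mem_nhds t₀ (half_pos hε)] with t ht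
  constructor
  · rintro _ ⟨_, ⟨x, hx, rfl⟩, _, ⟨y, hy, rfl⟩, rfl⟩
    exact ⟨_, add_mem_add (smul_mem_smul_set hx) (smul_mem_smul_set hy),
      key t₀ t ht (dist_comm t₀ t).le x hx y hy⟩
  · rintro _ ⟨_, ⟨x, hx, rfl⟩, _, ⟨y, hy, rfl⟩, rfl⟩
    exact ⟨_, add_mem_add (smul_mem_smul_set hx) (smul_mem_smul_set hy),
      key t₀ t ht (dist_comm t₀ t).le x hx y hy⟩

theorem continuous_area_minkowski (hK : IsUnitBody K) (hL : IsUnitBody L) :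
    Continuous fun t : ℝ => area ((1 - t) • K + t • L) :=
  continuous_iff_continuousAt.2 fun t₀ => tendsto_area
    (fun _ => isCompact_minkowski hK.isCompact hL.isCompact _ _)
    (fun _ => (hK.convex.smul _).add (hL.convex.smul _))
    (isCompact_minkowski hK.isCompact hL.isCompact _ _)
    ((hK.convex.smul _).add (hL.convex.smul _)) (hausdorffTendsto_minkowski hK hL t₀)

theorem isUnitBody_of_hausdorffTendsto {K : ℕ → Set Plane} (hK : ∀ n, IsUnitBody (K n))
    (hL : IsCompact L) (h : HausdorffTendsto atTop K L) : IsUnitBody L := by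
  have hmem : ∀ x : Plane, (∀ ε > 0, ∃ y ∈ L, dist x y ≤ ε) → x ∈ L := by
    intro x hx
    rw [← hL.isClosed.closure_eq, Metric.mem_closure_iff]
    intro ε hε
    obtain ⟨y, hy, hxy⟩ := hx (ε / 2) (half_pos hε)
    exact ⟨y, hy, by linarith⟩
  refine ⟨hL, ?_, ?_, ?_, ?_⟩
  · intro x hx y hy a b ha hb hab
    refine hmem _ fun ε hε => ?_
    obtain ⟨n, hn⟩ := (h (ε / 2) (half_pos hε)).exists
    obtain ⟨x', hx', hxx⟩ := hn.2 x hx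
    obtain ⟨y', hy', hyy⟩ := hn.2 y hy
    obtain ⟨z, hz, hzz⟩ := hn.1 _ ((hK n).convex hx' hy' ha hb hab)
    refine ⟨z, hz, ?_⟩
    have h1 : dist (a • x + b • y) (a • x' + b • y') ≤ ε / 2 := by
      calc dist (a • x + b • y) (a • x' + b • y')
          ≤ dist (a • x) (a • x') + dist (b • y) (b • y') := dist_add_add_le _ _ _ _
        _ = a * dist x' x + b * dist y' y := by
          rw [dist_smul₀, dist_smul₀, norm_eq_abs, norm_eq_abs, abs_of_nonneg ha,
            abs_of_nonneg hb, dist_comm x, dist_comm y]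
        _ ≤ a * (ε / 2) + b * (ε / 2) := by gcongr
        _ = ε / 2 := by rw [← add_mul, hab, one_mul]
    linarith [dist_triangle (a • x + b • y) (a • x' + b • y') z]
  · exact hmem _ fun ε hε => by
      obtain ⟨n, hn⟩ := (h ε hε).exists
      exact hn.1 _ (hK n).pole_mem
  · exact hmem _ fun ε hε => by
      obtain ⟨n, hn⟩ := (h ε hε).exists
      exact hn.1 _ (hK n).neg_pole_mem
  · intro x hx y hy
    refine le_of_forall_pos_le_add fun ε hε => ?_
    obtain ⟨n, hn⟩ := (h (ε / 2) (half_pos hε)).exists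
    obtain ⟨x', hx', hxx⟩ := hn.2 x hx
    obtain ⟨y', hy', hyy⟩ := hn.2 y hy
    have h1 := (hK n).dist_le x' hx' y' hy'
    have h2 := dist_triangle4 x x' y' y
    rw [dist_comm x x'] at h2
    linarith

theorem IsUnitBody.subset_closedBall (hK : IsUnitBody K) : K ⊆ Metric.closedBall pole 1 :=
  fun x hx => hK.dist_le x hx pole hK.pole_mem

/-- A form of Blaschke's selection theorem. -/
theorem exists_hausdorffTendsto_subseq {K : ℕ → Set Plane} (hK : ∀ n, IsUnitBody (K n)) :
    ∃ (L : Set Plane) (σ : ℕ → ℕ), StrictMono σ ∧ IsUnitBody L ∧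
      HausdorffTendsto atTop (fun n => K (σ n)) L := by
  let C : ℕ → TopologicalSpace.NonemptyCompacts Plane := fun n =>
    ⟨⟨K n, (hK n).isCompact⟩, (hK n).nonempty⟩
  obtain ⟨L, -, σ, hσ, hlim⟩ :=
    (TopologicalSpace.NonemptyCompacts.isCompact_subsets_of_isCompact
      (isCompact_closedBall pole 1)).tendsto_subseq (x := C) fun n => (hK n).subset_closedBall
  have hconv : HausdorffTendsto atTop (fun n => K (σ n)) (L : Set Plane) := by
    intro ε hε
    filter_upwards [Metric.tendsto_nhds.1 hlim ε hε] with n hn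
    rw [Metric.NonemptyCompacts.dist_eq] at hn
    have hfin : Metric.hausdorffEDist ((C (σ n) : Set Plane)) (L : Set Plane) ≠ ⊤ :=
      Metric.hausdorffEDist_ne_top_of_nonempty_of_bounded (C (σ n)).nonempty L.nonempty
        (C (σ n)).isCompact.isBounded L.isCompact.isBounded
    constructor
    · intro x hx
      obtain ⟨y, hy, hxy⟩ := Metric.exists_dist_lt_of_hausdorffDist_lt hx hn hfin
      exact ⟨y, hy, hxy.le⟩
    · intro y hy
      obtain ⟨x, hx, hxy⟩ := Metric.exists_dist_lt_of_hausdorffDist_lt' hy hn hfin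
      exact ⟨x, hx, hxy.le⟩
  exact ⟨L, σ, hσ, isUnitBody_of_hausdorffTendsto (fun n => hK (σ n)) L.isCompact hconv, hconv⟩

theorem IsUnitBody.width_le_one (hK : IsUnitBody K) {v : Plane} (hv : ‖v‖ = 1) :
    width K v ≤ 1 := by
  obtain ⟨x, hx, y, hy, h⟩ := exists_inner_sub_eq_width hK.isCompact hK.nonempty v
  have h1 := real_inner_le_norm v (x - y)
  rw [hv, one_mul, ← dist_eq_norm, h] at h1
  exact h1.trans (hK.dist_le x hx y hy)

theorem IsUnitBody.widthIntegral_le_pi (hK : IsUnitBody K) : widthIntegral K ≤ π := by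
  have h := intervalIntegral.integral_mono_on pi_pos.le (intervalIntegrable_width hK.isCompact 0 π)
    (intervalIntegrable_const (c := (1 : ℝ))) fun θ _ => hK.width_le_one (norm_dir θ)
  unfold widthIntegral
  simpa using h

theorem integral_abs_inner_dir_pole :
    ∫ θ in (0 : ℝ)..π, |⟪dir θ, pole - -pole⟫_ℝ| = 2 := by
  rw [integral_abs_inner_dir, norm_pole_sub_neg_pole, mul_one]

theorem continuous_abs_inner_dir_pole : Continuous fun θ => |⟪dir θ, pole - -pole⟫_ℝ| :=
  (continuous_dir.inner continuous_const).abs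

theorem IsUnitBody.two_le_widthIntegral (hK : IsUnitBody K) : 2 ≤ widthIntegral K := by
  rw [← integral_abs_inner_dir_pole]
  exact intervalIntegral.integral_mono_on pi_pos.le
    (continuous_abs_inner_dir_pole.intervalIntegrable _ _)
    (intervalIntegrable_width hK.isCompact _ _)
    fun θ _ => abs_inner_sub_le_width hK.isCompact _ hK.pole_mem hK.neg_pole_mem

theorem IsUnitBody.two_lt_widthIntegral (hK : IsUnitBody K) (hint : (interior K).Nonempty) :
    2 < widthIntegral K := by
  rw [← integral_abs_inner_dir_pole]
  refine intervalIntegral.integral_lt_integral_of_continuousOn_of_le_of_exists_lt pi_pos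
    continuous_abs_inner_dir_pole.continuousOn
    ((continuous_width hK.isCompact).comp continuous_dir).continuousOn
    (fun θ _ => abs_inner_sub_le_width hK.isCompact _ hK.pole_mem hK.neg_pole_mem)
    -- In the direction orthogonal to the poles their segment projects to a point, while an interior
    -- point gives positive width.
    ⟨π / 2, ⟨by positivity, by linarith [pi_pos]⟩, ?_⟩
  obtain ⟨x, hx⟩ := hint
  obtain ⟨r, hr, hball⟩ := Metric.nhds_basis_closedBall.mem_iff.1 (mem_interior_iff_mem_nhds.1 hx)
  have h1 : x + r • dir (π / 2) ∈ K := hball (by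
    rw [Metric.mem_closedBall, dist_eq_norm, add_sub_cancel_left, norm_smul, norm_dir, mul_one,
      norm_eq_abs, abs_of_pos hr])
  have h2 := inner_sub_le_width hK.isCompact (dir (π / 2)) h1 (interior_subset hx)
  rw [add_sub_cancel_left, inner_smul_right, real_inner_self_eq_norm_sq, norm_dir] at h2
  have h3 : ⟪dir (π / 2), pole - -pole⟫_ℝ = 0 := by simp [plane_inner]
  rw [h3, abs_zero]
  linarith

theorem IsUnitBody.widthIntegral_le_two (hK : IsUnitBody K) (h : ∀ x ∈ K, x 1 = 0) :
    widthIntegral K ≤ 2 := by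
  rw [← integral_abs_inner_dir_pole]
  refine intervalIntegral.integral_mono_on pi_pos.le
    (intervalIntegrable_width hK.isCompact _ _)
    (continuous_abs_inner_dir_pole.intervalIntegrable _ _) fun θ _ => ?_
  obtain ⟨x, hx, y, hy, hxy⟩ := exists_inner_sub_eq_width hK.isCompact hK.nonempty (dir θ)
  rw [← hxy, plane_inner, plane_inner]
  have h1 := plane_norm_sq (x - y)
  have h2 := hK.dist_le x hx y hy
  rw [dist_eq_norm] at h2
  simp [h x hx, h y hy] at h1 ⊢
  have h3 : |x 0 - y 0| ≤ 1 := by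
    rw [← sq_abs (x 0 - y 0)] at h1
    rwa [← (sq_eq_sq₀ (norm_nonneg _) (abs_nonneg _)).1 h1]
  calc cos θ * (x 0 - y 0) ≤ |cos θ| * |x 0 - y 0| := by rw [← abs_mul]; exact le_abs_self _
    _ ≤ |cos θ| * 1 := by gcongr
    _ = _ := by norm_num

theorem IsUnitBody.interior_nonempty (hK : IsUnitBody K) (h : 2 < widthIntegral K) :
    (interior K).Nonempty := by
  have hex : ∃ x ∈ K, x 1 ≠ 0 := by
    by_contra! hcon
    exact absurd (hK.widthIntegral_le_two hcon) (not_le.2 h)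
  obtain ⟨x, hx, hx1⟩ := hex
  -- `a` and `b` are the barycentric coordinates at `pole` and `x` in the triangle with vertices
  -- `-pole`, `pole`, `x`; the interior point found below is its centroid.
  let b : Plane → ℝ := fun y => y 1 / x 1
  let a : Plane → ℝ := fun y => y 0 + 1 / 2 - b y * (x 0 + 1 / 2)
  have hb : Continuous b := by fun_prop
  have ha : Continuous a := by fun_prop
  have hopen : IsOpen {y | 0 < b y ∧ 0 < a y ∧ a y + b y < 1} :=
    (isOpen_lt continuous_const hb).inter
      ((isOpen_lt continuous_const ha).inter (isOpen_lt (ha.add hb) continuous_const))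
  have hsub : {y | 0 < b y ∧ 0 < a y ∧ a y + b y < 1} ⊆ K := by
    rintro y ⟨h1, h2, h3⟩
    have hy : y = (1 - a y - b y) • -pole + a y • pole + b y • x := by
      apply plane_ext
      · simp [a]; ring
      · simp [b]; field_simp
    rw [hy]
    have hpos : 0 < 1 - b y := by linarith
    have h4 := hK.convex hK.neg_pole_mem hK.pole_mem (a := (1 - a y - b y) / (1 - b y))
      (b := a y / (1 - b y)) (div_nonneg (by linarith) hpos.le) (div_nonneg h2.le hpos.le)
      (by rw [← add_div, div_eq_one_iff_eq hpos.ne']; ring)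
    have h5 := hK.convex h4 hx hpos.le h1.le (by ring)
    rwa [smul_add, smul_smul, smul_smul, mul_div_cancel₀ _ hpos.ne', mul_div_cancel₀ _ hpos.ne']
      at h5
  refine ⟨(1 / 3 : ℝ) • x, interior_maximal hsub hopen ?_⟩
  have hb3 : b ((1 / 3 : ℝ) • x) = 1 / 3 := by simp [b]; field_simp
  have ha3 : a ((1 / 3 : ℝ) • x) = 1 / 3 := by simp only [a, hb3]; simp; ring
  change 0 < b _ ∧ 0 < a _ ∧ a _ + b _ < 1
  rw [ha3, hb3]
  norm_num

/-- The disc of unit diameter. -/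
noncomputable def unitDisc : Set Plane := Metric.closedBall 0 (1 / 2)

theorem isUnitBody_unitDisc : IsUnitBody unitDisc := by
  have hp : ‖pole‖ = 1 / 2 := by
    have h := norm_pole_sub_neg_pole
    rw [sub_neg_eq_add, ← two_smul ℝ, norm_smul] at h
    norm_num at h
    linarith
  refine ⟨isCompact_closedBall _ _, convex_closedBall _ _, ?_, ?_, ?_⟩
  · simp [unitDisc, hp]
  · simp [unitDisc, hp]
  · intro x hx y hy
    rw [unitDisc, Metric.mem_closedBall] at hx hy
    linarith [dist_triangle_right x y 0]

theorem isUnitBody_segment : IsUnitBody (segment ℝ (-pole) pole) := by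
  refine ⟨?_, convex_segment _ _, right_mem_segment _ _ _, left_mem_segment _ _ _, ?_⟩
  · rw [segment_eq_image_lineMap]
    exact isCompact_Icc.image AffineMap.lineMap_continuous
  · intro x hx y hy
    have hsub : segment ℝ (-pole) pole ⊆ unitDisc := isUnitBody_unitDisc.convex.segment_subset
      isUnitBody_unitDisc.neg_pole_mem isUnitBody_unitDisc.pole_mem
    exact isUnitBody_unitDisc.dist_le x (hsub hx) y (hsub hy)

theorem widthIntegral_segment : widthIntegral (segment ℝ (-pole) pole) = 2 := by
  refine le_antisymm (isUnitBody_segment.widthIntegral_le_two ?_)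
    isUnitBody_segment.two_le_widthIntegral
  rintro _ ⟨a, b, -, -, -, rfl⟩
  simp

theorem widthIntegral_unitDisc : widthIntegral unitDisc = π := by
  refine le_antisymm isUnitBody_unitDisc.widthIntegral_le_pi ?_
  have h := intervalIntegral.integral_mono_on pi_pos.le
    (intervalIntegrable_const (c := (1 : ℝ)))
    (intervalIntegrable_width isUnitBody_unitDisc.isCompact 0 π) fun θ _ => ?_
  · unfold widthIntegral
    simpa using h
  · have h1 : (1 / 2 : ℝ) • dir θ ∈ unitDisc := by simp [unitDisc, norm_smul]
    have h2 : -((1 / 2 : ℝ) • dir θ) ∈ unitDisc := by simp [unitDisc, norm_smul]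
    have h3 := inner_sub_le_width isUnitBody_unitDisc.isCompact (dir θ) h1 h2
    rw [inner_sub_right, inner_neg_right, inner_smul_right, real_inner_self_eq_norm_sq,
      norm_dir] at h3
    linarith

end UnitBody

/-! ### Decreasing the perimeter by vertical compression. -/

section Squash

open Set Real Filter Topology
open scoped Pointwise InnerProductSpace

/-- Scaling of the second coordinate. -/
noncomputable def squash (s : ℝ) : Plane →ₗ[ℝ] Plane where
  toFun x := !₂[x 0, s * x 1]
  map_add' x y := by apply plane_ext <;> simp [mul_add]
  map_smul' c x := by apply plane_ext <;> simp; ring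

@[simp] theorem squash_zero_apply (s : ℝ) (x : Plane) : squash s x 0 = x 0 := rfl
@[simp] theorem squash_one_apply (s : ℝ) (x : Plane) : squash s x 1 = s * x 1 := rfl

theorem det_squash (s : ℝ) : LinearMap.det (squash s) = s := by
  rw [← LinearMap.det_toMatrix (EuclideanSpace.basisFun (Fin 2) ℝ).toBasis, Matrix.det_fin_two]
  simp [LinearMap.toMatrix_apply]

variable {K L : Set Plane}

theorem area_squash {s : ℝ} (hs : 0 ≤ s) (K : Set Plane) : area (squash s '' K) = s * area K := by
  rw [area, Measure.addHaar_image_linearMap, det_squash, abs_of_nonneg hs, ENNReal.toReal_mul,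
    ENNReal.toReal_ofReal hs, area]

theorem squash_one (K : Set Plane) : squash 1 '' K = K := by
  have : ∀ x, squash 1 x = x := fun x => by apply plane_ext <;> simp
  simp [this]

theorem isCompact_squash (hK : IsCompact K) (s : ℝ) : IsCompact (squash s '' K) :=
  hK.image (squash s).continuous_of_finiteDimensional

theorem squash_pole (s : ℝ) : squash s pole = pole := by
  apply plane_ext <;> simp

theorem norm_squash_le {s : ℝ} (h0 : 0 ≤ s) (h1 : s ≤ 1) (x : Plane) : ‖squash s x‖ ≤ ‖x‖ := by
  rw [← sq_le_sq₀ (norm_nonneg _) (norm_nonneg _), plane_norm_sq, plane_norm_sq]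
  simp only [squash_zero_apply, squash_one_apply, mul_pow]
  have : s ^ 2 ≤ 1 := pow_le_one₀ h0 h1
  nlinarith [sq_nonneg (x 1)]

theorem IsUnitBody.squash (hK : IsUnitBody K) {s : ℝ} (h0 : 0 ≤ s) (h1 : s ≤ 1) :
    IsUnitBody (squash s '' K) := by
  refine ⟨isCompact_squash hK.isCompact s, hK.convex.linear_image _,
    ⟨pole, hK.pole_mem, squash_pole s⟩, ⟨-pole, hK.neg_pole_mem, by rw [map_neg, squash_pole]⟩, ?_⟩
  rintro _ ⟨x, hx, rfl⟩ _ ⟨y, hy, rfl⟩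
  rw [dist_eq_norm, ← map_sub]
  exact (norm_squash_le h0 h1 _).trans (dist_eq_norm x y ▸ hK.dist_le x hx y hy)

theorem abs_one_apply_le_norm (x : Plane) : |x 1| ≤ ‖x‖ := by
  rw [← sq_le_sq₀ (abs_nonneg _) (norm_nonneg _), plane_norm_sq, sq_abs]
  nlinarith [sq_nonneg (x 0)]

theorem hausdorffTendsto_squash (hK : IsUnitBody K) (s₀ : ℝ) :
    HausdorffTendsto (𝓝 s₀) (fun s => squash s '' K) (squash s₀ '' K) := by
  intro ε hε
  filter_upwards [Metric.ball_mem_nhds s₀ hε] with s hs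
  have key : ∀ x ∈ K, dist (squash s x) (squash s₀ x) ≤ ε := by
    intro x hx
    have h1 : |x 1| ≤ 1 := by
      have h2 := abs_one_apply_le_norm (x - pole)
      have h3 := hK.dist_le x hx pole hK.pole_mem
      rw [dist_eq_norm] at h3
      simp at h2
      linarith
    have h4 : squash s x - squash s₀ x = (s - s₀) • !₂[(0 : ℝ), x 1] := by
      apply plane_ext <;> simp; ring
    have h5 : ‖(!₂[(0 : ℝ), x 1] : Plane)‖ = |x 1| := by
      rw [← sq_eq_sq₀ (norm_nonneg _) (abs_nonneg _), plane_norm_sq, sq_abs]; simp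
    rw [dist_eq_norm, h4, norm_smul, h5, norm_eq_abs]
    have h7 : |s - s₀| ≤ ε := (Metric.mem_ball.1 hs).le
    nlinarith [abs_nonneg (x 1), abs_nonneg (s - s₀)]
  constructor
  · rintro _ ⟨x, hx, rfl⟩
    exact ⟨_, ⟨x, hx, rfl⟩, key x hx⟩
  · rintro _ ⟨x, hx, rfl⟩
    exact ⟨_, ⟨x, hx, rfl⟩, key x hx⟩

theorem area_pos (hK : IsCompact K) (hint : (interior K).Nonempty) : 0 < area K :=
  ENNReal.toReal_pos
    ((isOpen_interior.measure_pos volume hint).trans_le (measure_mono interior_subset)).ne'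
    hK.measure_ne_top

/-- The squashed width integral is continuous in `s` and at most 2 at `s = 0`, so it takes the value
`x` at some `s < 1`; the area, which is positive, is multiplied by `s`. -/
theorem IsUnitBody.exists_smaller_area (hK : IsUnitBody K) {x : ℝ} (hx : 2 < x)
    (hxK : x < widthIntegral K) :
    ∃ K', IsUnitBody K' ∧ widthIntegral K' = x ∧ area K' < area K := by
  have hcont : Continuous fun s : ℝ => widthIntegral (_root_.squash s '' K) :=
    continuous_iff_continuousAt.2 fun s₀ => tendsto_widthIntegral
      (fun s => isCompact_squash hK.isCompact s) (isCompact_squash hK.isCompact s₀)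
      (fun s => hK.nonempty.image _) (hK.nonempty.image _) (hausdorffTendsto_squash hK s₀)
  have h0 : widthIntegral (_root_.squash 0 '' K) ≤ 2 := by
    refine (hK.squash le_rfl zero_le_one).widthIntegral_le_two ?_
    rintro _ ⟨y, -, rfl⟩
    simp
  obtain ⟨s, ⟨hs0, hs1⟩, hs⟩ := intermediate_value_Icc zero_le_one hcont.continuousOn
    (show x ∈ Icc (widthIntegral (_root_.squash 0 '' K)) (widthIntegral (_root_.squash 1 '' K)) by
      rw [squash_one]; exact ⟨h0.trans hx.le, hxK.le⟩)
  refine ⟨_, hK.squash hs0 hs1, hs, ?_⟩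
  have hs1' : s < 1 := by
    refine lt_of_le_of_ne hs1 fun h => ?_
    simp only [h, squash_one] at hs
    exact hxK.ne' hs
  rw [area_squash hs0]
  have := area_pos hK.isCompact (hK.interior_nonempty (hx.trans hxK))
  nlinarith

end Squash

/-! ### Increasing the perimeter by symmetrization and interpolation with the disc. -/

section DifferenceBody

open Set Real Filter Topology
open scoped Pointwise InnerProductSpace

/-- One-dimensional Brunn–Minkowski: `A` shifted by `min B` and `B` shifted by `max A` lie in the
sum and meet only at `max A + min B`. -/
theorem volume_add_le_volume_minkowski {A B : Set ℝ} (hA : IsCompact A) (hB : IsCompact B)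
    (hAne : A.Nonempty) (hBne : B.Nonempty) : volume A + volume B ≤ volume (A + B) := by
  obtain ⟨a, ha, hamax⟩ := hA.exists_isGreatest hAne
  obtain ⟨b, hb, hbmin⟩ := hB.exists_isLeast hBne
  have hdisj : AEDisjoint volume ((fun x => x + b) '' A) ((fun x => a + x) '' B) := by
    refine measure_mono_null ?_ (measure_singleton (a + b))
    rintro _ ⟨⟨x, hx, rfl⟩, ⟨y, hy, hxy⟩⟩
    have h1 := hamax hx
    have h2 := hbmin hy
    simp only at hxy
    rw [mem_singleton_iff]
    simp only
    linarith
  calc volume A + volume B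
      = volume ((fun x => x + b) '' A) + volume ((fun x => a + x) '' B) := by
        rw [image_add_right, image_add_left, measure_preimage_add_right, measure_preimage_add]
    _ = volume ((fun x => x + b) '' A ∪ (fun x => a + x) '' B) :=
        (measure_union₀ ((hB.image (by fun_prop)).measurableSet.nullMeasurableSet) hdisj).symm
    _ ≤ volume (A + B) := by
        refine measure_mono (union_subset ?_ ?_)
        · rintro _ ⟨x, hx, rfl⟩
          exact add_mem_add hx hb
        · rintro _ ⟨x, hx, rfl⟩
          exact add_mem_add ha hx

theorem half_volume_add_le {A B : Set ℝ} (hA : IsCompact A) (hB : IsCompact B)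
    (hAne : A.Nonempty) (hBne : B.Nonempty) :
    volume.real A / 2 + volume.real B / 2 ≤
      volume.real ((1 / 2 : ℝ) • A + (1 / 2 : ℝ) • (-B)) := by
  have h := volume_add_le_volume_minkowski (hA.smul (1 / 2 : ℝ)) (hB.neg.smul (1 / 2 : ℝ))
    (hAne.smul_set) (hBne.neg.smul_set)
  rw [Measure.addHaar_smul, Measure.addHaar_smul, Measure.measure_neg] at h
  have hfin : volume ((1 / 2 : ℝ) • A + (1 / 2 : ℝ) • (-B)) ≠ ⊤ :=
    ((hA.smul _).add (hB.neg.smul _)).measure_ne_top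
  have h2 := ENNReal.toReal_mono hfin h
  rw [ENNReal.toReal_add (ENNReal.mul_ne_top ENNReal.ofReal_ne_top hA.measure_ne_top)
    (ENNReal.mul_ne_top ENNReal.ofReal_ne_top hB.measure_ne_top), ENNReal.toReal_mul,
    ENNReal.toReal_mul] at h2
  simp only [Module.finrank_self, pow_one] at h2
  rw [abs_of_pos (by norm_num : (0 : ℝ) < 1 / 2), ENNReal.toReal_ofReal (by norm_num)] at h2
  unfold Measure.real
  linarith

/-- The intersection of a planar set with a vertical line. -/
def slice (K : Set Plane) (a : ℝ) : Set ℝ := {b | !₂[a, b] ∈ K}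

variable {K : Set Plane}

theorem isCompact_slice (hK : IsCompact K) (a : ℝ) : IsCompact (slice K a) := by
  have : slice K a ⊆ (fun x : Plane => x 1) '' K := fun b hb => ⟨_, hb, rfl⟩
  refine (hK.image (by fun_prop)).of_isClosed_subset (hK.isClosed.preimage ?_) this
  refine (PiLp.continuous_toLp 2 _).comp (continuous_pi fun i => ?_)
  fin_cases i
  · exact continuous_const
  · exact continuous_id

theorem measurePreserving_plane :
    MeasurePreserving (fun p : ℝ × ℝ => (!₂[p.1, p.2] : Plane)) := by
  have h1 := (volume_preserving_finTwoArrow ℝ).symm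
  have h2 := EuclideanSpace.volume_preserving_symm_measurableEquiv_toLp (Fin 2)
  convert! h2.symm.comp h1 using 1

theorem measurable_slice (hK : IsCompact K) : Measurable fun a => volume.real (slice K a) :=
  (measurable_measure_prodMk_left
    (measurePreserving_plane.measurable hK.measurableSet)).ennreal_toReal

theorem volume_eq_lintegral_slice (hK : IsCompact K) :
    volume K = ∫⁻ a, ENNReal.ofReal (volume.real (slice K a)) := by
  rw [← measurePreserving_plane.measure_preimage hK.measurableSet.nullMeasurableSet,
    Measure.volume_eq_prod,
    Measure.prod_apply (measurePreserving_plane.measurable hK.measurableSet)]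
  refine lintegral_congr fun a => ?_
  exact (ENNReal.ofReal_toReal (isCompact_slice hK a).measure_ne_top).symm

/-- Central symmetrization does not decrease the area. -/
theorem volume_le_volume_symmetrization (hK : IsCompact K) :
    volume K ≤ volume ((1 / 2 : ℝ) • K + (1 / 2 : ℝ) • (-K)) := by
  have hD : IsCompact ((1 / 2 : ℝ) • K + (1 / 2 : ℝ) • (-K)) :=
    isCompact_minkowski hK hK.neg _ _
  rw [volume_eq_lintegral_slice hK, volume_eq_lintegral_slice hD,
    lintegral_eq_lintegral_meas_lt _ (.of_forall fun _ => measureReal_nonneg)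
      (measurable_slice hK).aemeasurable,
    lintegral_eq_lintegral_meas_lt _ (.of_forall fun _ => measureReal_nonneg)
      (measurable_slice hD).aemeasurable]
  refine setLIntegral_mono' measurableSet_Ioi fun t ht => ?_
  -- After the layer-cake formula for slice lengths, superlevel sets are compared. They are merely
  -- measurable, so inner regularity reduces to compact subsets, where the one-dimensional
  -- inequality applies.
  rw [(measurableSet_lt measurable_const (measurable_slice hK)).measure_eq_iSup_isCompact]
  refine iSup₂_le fun C hC => iSup_le fun hCc => ?_
  rcases C.eq_empty_or_nonempty with rfl | hCne
  · simp
  have hne : ∀ a, t < volume.real (slice K a) → (slice K a).Nonempty := by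
    intro a ha
    rw [nonempty_iff_ne_empty]
    intro h
    rw [h, measureReal_empty] at ha
    exact absurd (lt_trans ht ha) (lt_irrefl _)
  -- The half-sum of one slice of `K` and a reflected slice lies in a slice of the symmetrization,
  -- so the one-dimensional inequality is used here on slices and below on `C`.
  have hsub : (1 / 2 : ℝ) • C + (1 / 2 : ℝ) • (-C) ⊆
      {a | t < volume.real (slice ((1 / 2 : ℝ) • K + (1 / 2 : ℝ) • (-K)) a)} := by
    rintro _ ⟨_, ⟨a, ha, rfl⟩, _, ⟨c, hc, rfl⟩, rfl⟩
    have h1 : t < volume.real (slice K a) := hC ha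
    have h2 : t < volume.real (slice K (-c)) := hC hc
    have h3 := half_volume_add_le (isCompact_slice hK a) (isCompact_slice hK (-c)) (hne _ h1)
      (hne _ h2)
    refine lt_of_lt_of_le (by linarith) (h3.trans (measureReal_mono ?_
      (isCompact_slice hD _).measure_ne_top))
    rintro _ ⟨_, ⟨x, hx, rfl⟩, _, ⟨y, hy, rfl⟩, rfl⟩
    refine ⟨_, smul_mem_smul_set hx, _, smul_mem_smul_set (Set.neg_mem_neg.2 hy), ?_⟩
    apply plane_ext <;> simp
  refine le_trans ?_ (measure_mono hsub)
  have h := half_volume_add_le hCc hCc hCne hCne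
  rw [add_halves] at h
  exact (ENNReal.toReal_le_toReal hCc.measure_ne_top
    ((hCc.smul _).add (hCc.neg.smul _)).measure_ne_top).1 h

theorem IsUnitBody.neg (hK : IsUnitBody K) : IsUnitBody (-K) := by
  refine ⟨hK.isCompact.neg, hK.convex.neg, hK.neg_pole_mem, ?_, ?_⟩
  · rw [Set.neg_mem_neg]; exact hK.pole_mem
  · intro x hx y hy
    have := hK.dist_le _ hx _ hy
    rwa [dist_neg_neg] at this

/-- A point of `L` missed by the closed set `K` is a limit of interior points of `L`, so `K` misses
an open piece of positive area. -/
theorem area_lt_area_of_ssubset {L : Set Plane} (hK : IsCompact K) (hL : IsCompact L)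
    (hLconv : Convex ℝ L) (hint : (interior L).Nonempty) (h : K ⊂ L) : area K < area L := by
  obtain ⟨hKL, x, hxL, hxK⟩ := ssubset_iff_exists.1 h
  have hx : x ∈ closure (interior L) := by
    rw [hLconv.closure_interior_eq_closure_of_nonempty_interior hint]
    exact subset_closure hxL
  obtain ⟨y, hy⟩ := mem_closure_iff.1 hx Kᶜ hK.isClosed.isOpen_compl hxK
  have hpos : 0 < volume (Kᶜ ∩ interior L) :=
    (hK.isClosed.isOpen_compl.inter isOpen_interior).measure_pos _ ⟨y, hy⟩
  have hle : volume K + volume (Kᶜ ∩ interior L) ≤ volume L := by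
    rw [← measure_union' (disjoint_compl_right.mono_right inter_subset_left) hK.measurableSet]
    exact measure_mono (union_subset hKL (inter_subset_right.trans interior_subset))
  exact (ENNReal.toReal_lt_toReal hK.measure_ne_top hL.measure_ne_top).2
    ((ENNReal.lt_add_right hK.measure_ne_top hpos.ne').trans_le hle)

theorem IsUnitBody.exists_larger_area (hK : IsUnitBody K) {x : ℝ} (hxK : widthIntegral K < x)
    (hx : x ≤ π) : ∃ K', IsUnitBody K' ∧ widthIntegral K' = x ∧ area K < area K' := by
  set D : Set Plane := (1 / 2 : ℝ) • K + (1 / 2 : ℝ) • (-K) with hDdef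
  have hhalf : (1 - 1 / 2 : ℝ) = 1 / 2 := by norm_num
  have hD : IsUnitBody D := by
    have := hK.minkowski hK.neg (t := 1 / 2) (by norm_num) (by norm_num)
    rwa [hhalf] at this
  have hDw : widthIntegral D = widthIntegral K := by
    have := hK.widthIntegral_minkowski hK.neg (t := 1 / 2) (by norm_num) (by norm_num)
    rw [hhalf, widthIntegral_neg_set hK.isCompact hK.nonempty] at this
    linarith
  have hDarea : area K ≤ area D :=
    ENNReal.toReal_mono hD.isCompact.measure_ne_top (volume_le_volume_symmetrization hK.isCompact)
  -- Points of `D` are half-differences of points of `K`, hence of norm at most `1/2`.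
  have hDdisc : D ⊆ unitDisc := by
    rintro _ ⟨_, ⟨a, ha, rfl⟩, _, ⟨b, hb, rfl⟩, rfl⟩
    have h1 := hK.dist_le a ha (-b) hb
    rw [dist_eq_norm, sub_neg_eq_add] at h1
    simp only [unitDisc, mem_closedBall_zero_iff, ← smul_add, norm_smul]
    norm_num
    linarith
  -- Solution of `(1 - t) * widthIntegral K + t * π = x`.
  set t : ℝ := (x - widthIntegral K) / (π - widthIntegral K) with ht
  have hden : 0 < π - widthIntegral K := by linarith
  have ht0 : 0 ≤ t := div_nonneg (by linarith) hden.le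
  have ht1 : t ≤ 1 := (div_le_one hden).2 (by linarith)
  have hK' := hD.minkowski isUnitBody_unitDisc ht0 ht1
  have hw : widthIntegral ((1 - t) • D + t • unitDisc) = x := by
    rw [hD.widthIntegral_minkowski isUnitBody_unitDisc ht0 ht1, widthIntegral_unitDisc, hDw]
    have : t * (π - widthIntegral K) = x - widthIntegral K := div_mul_cancel₀ _ hden.ne'
    linarith
  refine ⟨_, hK', hw, hDarea.trans_lt (area_lt_area_of_ssubset hD.isCompact hK'.isCompact
    hK'.convex (hK'.interior_nonempty ?_) ?_)⟩
  · rw [hw]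
    exact hK.two_le_widthIntegral.trans_lt hxK
  -- The interpolant contains `D` because the disc does, and differs from it because the perimeters
  -- differ.
  · refine (ssubset_iff_subset_ne).2 ⟨fun z hz => ?_, fun h => ?_⟩
    · have hz' : z = (1 - t) • z + t • z := by rw [← add_smul]; simp
      rw [hz']
      exact add_mem_add (smul_mem_smul_set hz) (smul_mem_smul_set (hDdisc hz))
    · rw [← h, hDw] at hw
      exact hxK.ne hw

end DifferenceBody

/-! ### Envelopes of a compact region with increasing fibers. -/

section FiberExtrema

open Set Filter Topology

/-- The set of second coordinates over `x`. -/
def fiber (G : Set (ℝ × ℝ)) (x : ℝ) : Set ℝ := {y | (x, y) ∈ G}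

/-- A compact planar set such that any two of its points are joined inside it by a
graph-like path, and whose lower and upper envelopes strictly increase on `(a, b]`. -/
structure IsIncreasingRegion (G : Set (ℝ × ℝ)) (a b : ℝ) : Prop where
  lt : a < b
  isCompact : IsCompact G
  path : ∀ p ∈ G, ∀ q ∈ G, ∃ γ : ℝ → ℝ, Continuous γ ∧ γ 0 = p.2 ∧ γ 1 = q.2 ∧
    ∀ t ∈ Icc (0 : ℝ) 1, ((1 - t) * p.1 + t * q.1, γ t) ∈ G
  exists_lower : ∀ p ∈ G, ∀ x, a < x → x < p.1 → ∃ y < p.2, (x, y) ∈ G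
  exists_upper : ∀ p ∈ G, ∀ x, p.1 < x → x ≤ b → ∃ y, p.2 < y ∧ (x, y) ∈ G
  left : (fiber G a).Nonempty
  right : (fiber G b).Nonempty

namespace IsIncreasingRegion

variable {G : Set (ℝ × ℝ)} {a b x : ℝ}

theorem isCompact_fiber (h : IsIncreasingRegion G a b) (x : ℝ) : IsCompact (fiber G x) :=
  (h.isCompact.image continuous_snd).of_isClosed_subset
    (h.isCompact.isClosed.preimage (by fun_prop : Continuous fun y : ℝ => (x, y)))
    fun y hy => ⟨(x, y), hy, rfl⟩

theorem fiber_nonempty (h : IsIncreasingRegion G a b) (hx : x ∈ Icc a b) :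
    (fiber G x).Nonempty := by
  obtain ⟨y₀, h₀⟩ := h.left
  obtain ⟨y₁, h₁⟩ := h.right
  obtain ⟨γ, -, -, -, hγ⟩ := h.path _ h₀ _ h₁
  have hab : 0 < b - a := sub_pos.2 h.lt
  have ht := hγ ((x - a) / (b - a)) ⟨div_nonneg (sub_nonneg.2 hx.1) hab.le,
    (div_le_one hab).2 (by linarith [hx.2])⟩
  have hx' : (1 - (x - a) / (b - a)) * a + (x - a) / (b - a) * b = x := by field_simp; ring
  simp only [hx'] at ht
  exact ⟨_, ht⟩

theorem isLeast (h : IsIncreasingRegion G a b) (hx : x ∈ Icc a b) :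
    IsLeast (fiber G x) (sInf (fiber G x)) :=
  (h.isCompact_fiber x).isLeast_sInf (h.fiber_nonempty hx)

theorem isGreatest (h : IsIncreasingRegion G a b) (hx : x ∈ Icc a b) :
    IsGreatest (fiber G x) (sSup (fiber G x)) :=
  (h.isCompact_fiber x).isGreatest_sSup (h.fiber_nonempty hx)

/-- A path joining the two extreme points stays over `x`, so the intermediate value theorem fills
the interval. -/
theorem fiber_eq_Icc (h : IsIncreasingRegion G a b) (hx : x ∈ Icc a b) :
    fiber G x = Icc (sInf (fiber G x)) (sSup (fiber G x)) := by
  refine Subset.antisymm (fun y hy => ⟨(h.isLeast hx).2 hy, (h.isGreatest hx).2 hy⟩) ?_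
  obtain ⟨γ, hc, h0, h1, hγ⟩ := h.path _ (h.isLeast hx).1 _ (h.isGreatest hx).1
  intro y hy
  obtain ⟨t, ht, rfl⟩ := intermediate_value_Icc zero_le_one hc.continuousOn
    (show y ∈ Icc (γ 0) (γ 1) by rwa [h0, h1])
  have := hγ t ht
  have hx' : (1 - t) * x + t * x = x := by ring
  simp only [hx'] at this
  exact this

theorem strictMonoOn_sInf (h : IsIncreasingRegion G a b) :
    StrictMonoOn (fun x => sInf (fiber G x)) (Ioc a b) := by
  intro x hx z hz hxz
  obtain ⟨y, hy, hyG⟩ := h.exists_lower _ (h.isLeast (Ioc_subset_Icc_self hz)).1 x hx.1 hxz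
  exact ((h.isLeast (Ioc_subset_Icc_self hx)).2 hyG).trans_lt hy

theorem strictMonoOn_sSup (h : IsIncreasingRegion G a b) :
    StrictMonoOn (fun x => sSup (fiber G x)) (Ioc a b) := by
  intro x hx z hz hxz
  obtain ⟨y, hy, hyG⟩ := h.exists_upper _ (h.isGreatest (Ioc_subset_Icc_self hx)).1 z hxz hz.2
  exact hy.trans_le ((h.isGreatest (Ioc_subset_Icc_self hz)).2 hyG)

/-- Lower semicontinuity comes from compactness. For the upper bound, monotonicity handles the left
of `x₀`, and a path from the lowest point to the fiber over `b` handles the right. -/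
theorem continuousOn_sInf (h : IsIncreasingRegion G a b) :
    ContinuousOn (fun x => sInf (fiber G x)) (Ioc a b) := by
  intro x₀ hx₀
  have hx₀' := Ioc_subset_Icc_self hx₀
  refine tendsto_order.2 ⟨fun c hc => ?_, fun c hc => ?_⟩
  · have hcl : IsClosed (Prod.fst '' (G ∩ {p | p.2 ≤ c})) :=
      ((h.isCompact.inter_right (isClosed_le continuous_snd continuous_const)).image
        continuous_fst).isClosed
    have hx : x₀ ∈ (Prod.fst '' (G ∩ {p | p.2 ≤ c}))ᶜ := by
      rintro ⟨⟨x, y⟩, ⟨hG, hy⟩, rfl⟩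
      exact absurd ((h.isLeast hx₀').2 hG) (not_le.2 (lt_of_le_of_lt hy hc))
    filter_upwards [mem_nhdsWithin_of_mem_nhds (hcl.isOpen_compl.mem_nhds hx),
      self_mem_nhdsWithin] with x hxc hxI
    by_contra hcon
    exact hxc ⟨_, ⟨(h.isLeast (Ioc_subset_Icc_self hxI)).1, not_lt.1 hcon⟩, rfl⟩
  · obtain ⟨y₁, h₁⟩ := h.right
    obtain ⟨γ, hγc, h0, -, hγ⟩ := h.path _ (h.isLeast hx₀').1 _ h₁
    -- If `x₀ = b` the quotient is 0 by convention, and the case `x₀ < x` below is void.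
    have hcont : Continuous fun x => γ ((x - x₀) / (b - x₀)) := by fun_prop
    have hlt : γ ((x₀ - x₀) / (b - x₀)) < c := by rw [sub_self, zero_div, h0]; exact hc
    filter_upwards [mem_nhdsWithin_of_mem_nhds (hcont.continuousAt.eventually_lt
      continuousAt_const hlt), self_mem_nhdsWithin] with x hxc hxI
    rcases le_or_gt x x₀ with hle | hgt
    · exact (h.strictMonoOn_sInf.monotoneOn hxI hx₀ hle).trans_lt hc
    · have hpos : 0 < b - x₀ := by linarith [hxI.2]
      have ht := hγ ((x - x₀) / (b - x₀)) ⟨div_nonneg (sub_pos.2 hgt).le hpos.le,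
        (div_le_one hpos).2 (by linarith [hxI.2])⟩
      have hx' : (1 - (x - x₀) / (b - x₀)) * x₀ + (x - x₀) / (b - x₀) * b = x := by
        field_simp; ring
      simp only [hx'] at ht
      exact ((h.isLeast (Ioc_subset_Icc_self hxI)).2 ht).trans_lt hxc

/-- The mirror argument, with a path to the fiber over `a`; this is why the region must include that
endpoint. -/
theorem continuousOn_sSup (h : IsIncreasingRegion G a b) :
    ContinuousOn (fun x => sSup (fiber G x)) (Ioc a b) := by
  intro x₀ hx₀
  have hx₀' := Ioc_subset_Icc_self hx₀
  refine tendsto_order.2 ⟨fun c hc => ?_, fun c hc => ?_⟩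
  · obtain ⟨y₁, h₁⟩ := h.left
    obtain ⟨γ, hγc, h0, -, hγ⟩ := h.path _ (h.isGreatest hx₀').1 _ h₁
    have hcont : Continuous fun x => γ ((x₀ - x) / (x₀ - a)) := by fun_prop
    have hlt : c < γ ((x₀ - x₀) / (x₀ - a)) := by rw [sub_self, zero_div, h0]; exact hc
    filter_upwards [mem_nhdsWithin_of_mem_nhds (continuousAt_const.eventually_lt
      hcont.continuousAt hlt), self_mem_nhdsWithin] with x hxc hxI
    rcases le_or_gt x₀ x with hle | hgt
    · exact hc.trans_le (h.strictMonoOn_sSup.monotoneOn hx₀ hxI hle)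
    · have hpos : 0 < x₀ - a := by linarith [hx₀.1]
      have ht := hγ ((x₀ - x) / (x₀ - a)) ⟨div_nonneg (sub_pos.2 hgt).le hpos.le,
        (div_le_one hpos).2 (by linarith [hxI.1])⟩
      have hx' : (1 - (x₀ - x) / (x₀ - a)) * x₀ + (x₀ - x) / (x₀ - a) * a = x := by
        field_simp; ring
      simp only [hx'] at ht
      exact hxc.trans_le ((h.isGreatest (Ioc_subset_Icc_self hxI)).2 ht)
  · have hcl : IsClosed (Prod.fst '' (G ∩ {p | c ≤ p.2})) :=
      ((h.isCompact.inter_right (isClosed_le continuous_const continuous_snd)).image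
        continuous_fst).isClosed
    have hx : x₀ ∈ (Prod.fst '' (G ∩ {p | c ≤ p.2}))ᶜ := by
      rintro ⟨⟨x, y⟩, ⟨hG, hy⟩, rfl⟩
      exact absurd ((h.isGreatest hx₀').2 hG) (not_le.2 (lt_of_lt_of_le hc hy))
    filter_upwards [mem_nhdsWithin_of_mem_nhds (hcl.isOpen_compl.mem_nhds hx),
      self_mem_nhdsWithin] with x hxc hxI
    by_contra hcon
    exact hxc ⟨_, ⟨(h.isGreatest (Ioc_subset_Icc_self hxI)).1, not_lt.1 hcon⟩, rfl⟩

end IsIncreasingRegion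

/-- The region between two continuous graphs over a convex set is contractible. -/
theorem contractibleSpace_between {s : Set ℝ} (hs : Convex ℝ s) (hne : s.Nonempty) {f g : ℝ → ℝ}
    (hf : ContinuousOn f s) (hfg : ∀ x ∈ s, f x ≤ g x) :
    ContractibleSpace {p : ℝ × ℝ | p.1 ∈ s ∧ f p.1 ≤ p.2 ∧ p.2 ≤ g p.1} := by
  set D := {p : ℝ × ℝ | p.1 ∈ s ∧ f p.1 ≤ p.2 ∧ p.2 ≤ g p.1}
  have : ContractibleSpace s := hs.contractibleSpace hne
  have hfs : Continuous fun x : s => f x := continuousOn_iff_continuous_domRestrict.1 hf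
  let proj : C(D, s) := ⟨fun p => ⟨p.1.1, p.2.1⟩, by fun_prop⟩
  let sec : C(s, D) := ⟨fun x => ⟨(x, f x), x.2, le_rfl, hfg x x.2⟩,
    (continuous_subtype_val.prodMk hfs).subtype_mk _⟩
  have hfp : Continuous fun p : D => f p.1.1 := hfs.comp proj.continuous
  -- Vertical straight lines connect the retraction onto the lower graph with the identity.
  let H : (sec.comp proj).Homotopy (ContinuousMap.id D) :=
    { toFun := fun q => ⟨(q.2.1.1, (1 - (q.1 : ℝ)) * f q.2.1.1 + (q.1 : ℝ) * q.2.1.2), by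
        obtain ⟨⟨t, ht0, ht1⟩, ⟨⟨x, y⟩, hx, hy1, hy2⟩⟩ := q
        refine ⟨hx, ?_, ?_⟩
        · simp only at *
          nlinarith
        · simp only at *
          nlinarith⟩
      continuous_toFun := by
        have := hfp.comp (continuous_snd (X := unitInterval) (Y := D))
        refine Continuous.subtype_mk (Continuous.prodMk (by fun_prop) ?_) _
        exact ((continuous_const.sub (by fun_prop)).mul this).add (by fun_prop)
      map_zero_left := fun p => by simp [sec, proj]
      map_one_left := fun p => by simp }
  let e : ContinuousMap.HomotopyEquiv D s :=
    { toFun := proj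
      invFun := sec
      left_inv := ⟨H⟩
      right_inv := by
        have : proj.comp sec = ContinuousMap.id s := by ext; rfl
        rw [this] }
  exact e.contractibleSpace

end FiberExtrema

/-! ### From normalized bodies to the diagram. -/

section Diagram

open Set Filter Topology
open scoped Pointwise

/-- The pairs of perimeter (in the sense of Cauchy's formula) and area of unit bodies. -/
def unitBodyRegion : Set (ℝ × ℝ) :=
  {p | ∃ K, IsUnitBody K ∧ p = (widthIntegral K, area K)}

theorem isCompact_unitBodyRegion : IsCompact unitBodyRegion := by
  refine IsSeqCompact.isCompact fun p hp => ?_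
  choose K hK hpK using hp
  obtain ⟨L, σ, hσ, hL, hconv⟩ := exists_hausdorffTendsto_subseq hK
  refine ⟨_, ⟨L, hL, rfl⟩, σ, hσ, ?_⟩
  have h1 := tendsto_widthIntegral (fun n => (hK (σ n)).isCompact) hL.isCompact
    (fun n => (hK (σ n)).nonempty) hL.nonempty hconv
  have h2 := tendsto_area (fun n => (hK (σ n)).isCompact) (fun n => (hK (σ n)).convex)
    hL.isCompact hL.convex hconv
  exact (h1.prodMk_nhds h2).congr fun n => (hpK (σ n)).symm

theorem isIncreasingRegion_unitBodyRegion : IsIncreasingRegion unitBodyRegion 2 Real.pi where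
  lt := by linarith [Real.pi_gt_three]
  isCompact := isCompact_unitBodyRegion
  path := by
    rintro _ ⟨K, hK, rfl⟩ _ ⟨L, hL, rfl⟩
    refine ⟨fun t => area ((1 - t) • K + t • L), continuous_area_minkowski hK hL, ?_, ?_,
      fun t ht => ⟨_, hK.minkowski hL ht.1 ht.2, ?_⟩⟩
    · simp only [sub_zero, one_smul]
      rw [zero_smul_set hL.nonempty, add_zero]
    · simp only [sub_self, one_smul]
      rw [zero_smul_set hK.nonempty, zero_add]
    · rw [hK.widthIntegral_minkowski hL ht.1 ht.2]
  exists_lower := by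
    rintro _ ⟨K, hK, rfl⟩ x hx hxK
    obtain ⟨K', h1, h2, h3⟩ := hK.exists_smaller_area hx hxK
    exact ⟨area K', h3, K', h1, by rw [h2]⟩
  exists_upper := by
    rintro _ ⟨K, hK, rfl⟩ x hxK hx
    obtain ⟨K', h1, h2, h3⟩ := hK.exists_larger_area hxK hx
    exact ⟨area K', h3, K', h1, by rw [h2]⟩
  left := ⟨_, _, isUnitBody_segment, by rw [widthIntegral_segment]⟩
  right := ⟨_, _, isUnitBody_unitDisc, by rw [widthIntegral_unitDisc]⟩

theorem IsUnitBody.diam_eq_one {K : Set Plane} (hK : IsUnitBody K) : Metric.diam K = 1 := by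
  refine le_antisymm (Metric.diam_le_of_forall_dist_le zero_le_one hK.dist_le) ?_
  rw [← norm_pole_sub_neg_pole, ← dist_eq_norm]
  exact Metric.dist_le_diam_of_mem hK.isCompact.isBounded hK.pole_mem hK.neg_pole_mem

theorem IsUnitBody.mem_planarConvexBodies {K : Set Plane} (hK : IsUnitBody K)
    (h : 2 < widthIntegral K) : K ∈ planarConvexBodies ∧ perimeter K = widthIntegral K :=
  have hint := hK.interior_nonempty h
  ⟨⟨hK.convex, hK.isCompact.isBounded, hint⟩,
    perimeter_eq_widthIntegral hK.convex hK.isCompact hint⟩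

theorem perimeter_image (e : Plane ≃ᵢ Plane) (K : Set Plane) :
    perimeter (e '' K) = perimeter K := by
  rw [perimeter, hausdorffMeasure_frontier_image, perimeter]

theorem area_image_linearIsometryEquiv (e : Plane ≃ₗᵢ[ℝ] Plane) (K : Set Plane) :
    area (e '' K) = area K := by
  have h : e '' K = e.symm ⁻¹' K := e.toEquiv.image_eq_preimage_symm K
  rw [area, h, e.symm.measurePreserving.measure_preimage_emb
    e.symm.toHomeomorph.measurableEmbedding, area]

theorem area_image_add_left (v : Plane) (K : Set Plane) : area ((fun x => v + x) '' K) = area K := by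
  rw [area, image_add_left, measure_preimage_add, area]

/-- A convex set with interior points has the same interior as its closure, hence the same frontier.
-/
theorem perimeter_closure {Ω : Set Plane} (hΩ : Convex ℝ Ω) (hint : (interior Ω).Nonempty) :
    perimeter (closure Ω) = perimeter Ω := by
  unfold perimeter
  rw [frontier, closure_closure, hΩ.interior_closure_eq_interior_of_nonempty_interior hint, frontier]

theorem area_closure {Ω : Set Plane} (hΩ : Convex ℝ Ω) : area (closure Ω) = area Ω := by
  unfold area
  congr 1
  refine le_antisymm ?_ (measure_mono subset_closure)
  calc volume (closure Ω) = volume (Ω ∪ frontier Ω) := by rw [closure_eq_self_union_frontier]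
    _ ≤ volume Ω + volume (frontier Ω) := measure_union_le _ _
    _ = volume Ω := by rw [hΩ.addHaar_frontier volume, add_zero]

theorem exists_linearIsometryEquiv_apply_eq {E : Type*} [NormedAddCommGroup E]
    [InnerProductSpace ℝ E] [CompleteSpace E] {v w : E} (h : ‖v‖ = ‖w‖) :
    ∃ R : E ≃ₗᵢ[ℝ] E, R v = w :=
  ⟨_, Submodule.reflection_sub h⟩

/-- A planar convex body of unit diameter is congruent, up to closure, to a unit body. -/
theorem exists_isUnitBody {Ω : Set Plane} (hΩ : Ω ∈ planarConvexBodies)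
    (hdiam : Metric.diam Ω = 1) :
    ∃ K, IsUnitBody K ∧ 2 < widthIntegral K ∧ widthIntegral K = perimeter Ω ∧ area K = area Ω := by
  obtain ⟨hconv, hbdd, hint⟩ := hΩ
  have hC : IsCompact (closure Ω) := Metric.isCompact_of_isClosed_isBounded isClosed_closure
    hbdd.closure
  have hCint : (interior (closure Ω)).Nonempty := hint.mono (interior_mono subset_closure)
  have hCne : (closure Ω).Nonempty := hCint.mono interior_subset
  have hdist : ∀ x ∈ closure Ω, ∀ y ∈ closure Ω, dist x y ≤ 1 := by
    intro x hx y hy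
    rw [← hdiam, ← Metric.diam_closure]
    exact Metric.dist_le_diam_of_mem hC.isBounded hx hy
  obtain ⟨⟨x, y⟩, ⟨hx, hy⟩, hmax⟩ := (hC.prod hC).exists_isMaxOn (hCne.prod hCne)
    (f := fun p => dist p.1 p.2) continuous_dist.continuousOn
  have hxy : dist x y = 1 := by
    refine le_antisymm (hdist x hx y hy) ?_
    rw [← hdiam, ← Metric.diam_closure]
    exact Metric.diam_le_of_forall_dist_le dist_nonneg fun a ha b hb =>
      isMaxOn_iff.1 hmax (a, b) ⟨ha, hb⟩
  obtain ⟨R, hR⟩ := exists_linearIsometryEquiv_apply_eq (v := x - y) (w := pole - -pole)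
    (by rw [← dist_eq_norm, hxy, norm_pole_sub_neg_pole])
  -- Translation by `m` centers the diameter `x y` at the origin, and `R` then carries it to the
  -- poles.
  let m : Plane := -((1 / 2 : ℝ) • (x + y))
  let e : Plane ≃ᵢ Plane := (IsometryEquiv.addLeft m).trans R.toIsometryEquiv
  have he : ∀ z, e z = R (m + z) := fun z => rfl
  have hex : e x = pole := by
    rw [he, show m + x = (1 / 2 : ℝ) • (x - y) by simp only [m]; module, map_smul, hR]
    module
  have hey : e y = -pole := by
    rw [he, show m + y = -((1 / 2 : ℝ) • (x - y)) by simp only [m]; module, map_neg, map_smul, hR]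
    module
  have himg : e '' closure Ω = R '' ((fun z => m + z) '' closure Ω) := by
    rw [image_image]; rfl
  have hK : IsUnitBody (e '' closure Ω) := by
    refine ⟨hC.image e.continuous, ?_, ⟨x, hx, hex⟩, ⟨y, hy, hey⟩, ?_⟩
    · rw [himg]
      exact (hconv.closure.translate m).linear_image R.toLinearEquiv.toLinearMap
    · rintro _ ⟨a, ha, rfl⟩ _ ⟨b, hb, rfl⟩
      rw [e.dist_eq]
      exact hdist a ha b hb
  have hKint : (interior (e '' closure Ω)).Nonempty := by
    have h : interior (e '' closure Ω) = e '' interior (closure Ω) :=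
      (e.toHomeomorph.image_interior _).symm
    rw [h]
    exact hCint.image _
  refine ⟨_, hK, hK.two_lt_widthIntegral hKint, ?_, ?_⟩
  · rw [← perimeter_eq_widthIntegral hK.convex hK.isCompact hKint, perimeter_image,
      perimeter_closure hconv hint]
  · rw [himg, area_image_linearIsometryEquiv, area_image_add_left, area_closure hconv]

/-- The bound `2 < x` excludes flat unit bodies, which have no interior. -/
theorem areaValues_eq_fiber {x : ℝ} (hx : 2 < x) : areaValues x = fiber unitBodyRegion x := by
  ext a
  constructor
  · rintro ⟨Ω, hΩ, hd, rfl, rfl⟩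
    obtain ⟨K, hK, -, h1, h2⟩ := exists_isUnitBody hΩ hd
    exact ⟨K, hK, by rw [h1, h2]⟩
  · rintro ⟨K, hK, h⟩
    obtain ⟨rfl, rfl⟩ := Prod.mk.inj h
    obtain ⟨h1, h2⟩ := hK.mem_planarConvexBodies hx
    exact ⟨K, h1, hK.diam_eq_one, h2, rfl⟩

theorem mem_diagramPAd_iff (p : ℝ × ℝ) :
    p ∈ diagramPAd ↔ p.1 ∈ Ioc 2 Real.pi ∧ p.2 ∈ areaValues p.1 := by
  constructor
  · rintro ⟨Ω, hΩ, hd, rfl⟩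
    obtain ⟨K, hK, h0, h1, -⟩ := exists_isUnitBody hΩ hd
    exact ⟨⟨h1 ▸ h0, h1 ▸ hK.widthIntegral_le_pi⟩, Ω, hΩ, hd, rfl, rfl⟩
  · rintro ⟨-, Ω, hΩ, hd, h1, h2⟩
    exact ⟨Ω, hΩ, hd, Prod.ext h1.symm h2.symm⟩

end Diagram

theorem theorem1 :
    (∀ x ∈ Set.Ioc 2 Real.pi, IsGLB (areaValues x) (phi x) ∧ IsLUB (areaValues x) (psi x)) ∧
    (ContinuousOn phi (Set.Ioc 2 Real.pi) ∧ StrictMonoOn phi (Set.Ioc 2 Real.pi)) ∧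
    (ContinuousOn psi (Set.Ioc 2 Real.pi) ∧ StrictMonoOn psi (Set.Ioc 2 Real.pi)) ∧
    diagramPAd = {p : ℝ × ℝ | p.1 ∈ Set.Ioc 2 Real.pi ∧ phi p.1 ≤ p.2 ∧ p.2 ≤ psi p.1} ∧
    SimplyConnectedSpace diagramPAd := by
  have hG := isIncreasingRegion_unitBodyRegion
  have hphi : Set.EqOn phi (fun x => sInf (fiber unitBodyRegion x)) (Set.Ioc 2 Real.pi) :=
    fun x hx => by rw [phi, areaValues_eq_fiber hx.1]
  have hpsi : Set.EqOn psi (fun x => sSup (fiber unitBodyRegion x)) (Set.Ioc 2 Real.pi) :=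
    fun x hx => by rw [psi, areaValues_eq_fiber hx.1]
  have hIcc : ∀ x ∈ Set.Ioc 2 Real.pi, areaValues x = Set.Icc (phi x) (psi x) := fun x hx => by
    rw [hphi hx, hpsi hx, areaValues_eq_fiber hx.1]
    exact hG.fiber_eq_Icc (Set.Ioc_subset_Icc_self hx)
  have hext : ∀ x ∈ Set.Ioc 2 Real.pi,
      IsGLB (areaValues x) (phi x) ∧ IsLUB (areaValues x) (psi x) := fun x hx => by
    rw [hphi hx, hpsi hx, areaValues_eq_fiber hx.1]
    exact ⟨(hG.isLeast (Set.Ioc_subset_Icc_self hx)).isGLB,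
      (hG.isGreatest (Set.Ioc_subset_Icc_self hx)).isLUB⟩
  have hcont : ContinuousOn phi (Set.Ioc 2 Real.pi) := hG.continuousOn_sInf.congr hphi
  have hD : diagramPAd =
      {p : ℝ × ℝ | p.1 ∈ Set.Ioc 2 Real.pi ∧ phi p.1 ≤ p.2 ∧ p.2 ≤ psi p.1} := by
    ext p
    rw [mem_diagramPAd_iff]
    exact and_congr_right fun hp => by rw [hIcc _ hp]; rfl
  refine ⟨hext, ⟨hcont, hG.strictMonoOn_sInf.congr hphi.symm⟩,
    ⟨hG.continuousOn_sSup.congr hpsi, hG.strictMonoOn_sSup.congr hpsi.symm⟩, hD, ?_⟩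
  rw [hD]
  have hne : ∀ x ∈ Set.Ioc 2 Real.pi, phi x ≤ psi x := fun x hx => by
    have h := hG.fiber_nonempty (Set.Ioc_subset_Icc_self hx)
    rw [← areaValues_eq_fiber hx.1, hIcc x hx] at h
    exact Set.nonempty_Icc.1 h
  have := contractibleSpace_between (convex_Ioc 2 Real.pi) (Set.nonempty_Ioc.2 hG.lt) hcont hne
  infer_instance
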